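/- Let $n\ge 0$ and let $M$ be a spacetime of dimension $1+n$: a smooth Hausdorff manifold without boundary (neither connectedness nor second countability is needed) with a smooth metric $g$ such that every $g_x$ is a symmetric bilinear form on $T_xM$ equal to $\mathrm{diag}(-1,1,\dots,1)$ in a suitable basis, and with a time orientation, that is, a continuous vector field $T$ with $g_x(T_x,T_x)<0$ for all $x\in M$. A tangent vector $v\in T_xM$ is called \emph{causal} if $v\ne 0$ and $g_x(v,v)\le 0$, and \emph{future directed} if $g_x(T_x,v)<0$. A \emph{causal curve} from $x$ to $y$ is a continuous piecewise smooth map $\gamma\colon[a,b]\to M$ with $a<b$, $\gamma(a)=x$, $\gamma(b)=y$, all of whose velocity vectors (one-sided ones at end points and break points) are future directed and causal. The \emph{after} (strict causal) relation $\alpha$ on $M$ is defined by: $x\mathrel{\alpha}y$ if and only if there is a causal curve from $x$ to $y$. Then the Kripke frame $(M,\alpha)$ validates the \emph{after formula} \[ \Diamond\bigl(\Diamond(p_1\land\lnot p_2\land\Box\lnot p_2)\land\Diamond(p_2\land\lnot p_1\land\Box\lnot p_1)\bigr)\land\Diamond q \;\Rightarrow\; \Diamond(\Diamond p_1\land\Diamond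 q)\lor\Diamond(\Diamond p_2\land\Diamond q), \] where $p_1,p_2,q$ are atomic propositions: for every valuation $V$, assigning to each atomic proposition a subset of $M$, the formula is true at every point of the model $(M,\alpha,V)$. Here $\Box\varphi$ is true at $x$ if and only if $\varphi$ is true at every $y$ with $x\mathrel{\alpha}y$, and $\Diamond=\lnot\Box\lnot$. -/

import Mathlib

open scoped Manifold ContDiff Bundle

/-! ### Modal logic -/

/-- Formulas of propositional modal logic over a type `AP` of atomic propositions. -/
inductive ModalFormula (AP : Type*) where
  | top : ModalFormula AP
  | atom : AP → ModalFormula AP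
  | or : ModalFormula AP → ModalFormula AP → ModalFormula AP
  | neg : ModalFormula AP → ModalFormula AP
  | box : ModalFormula AP → ModalFormula AP

namespace ModalFormula

variable {AP : Type*}

/-- Conjunction. -/
def and (φ ψ : ModalFormula AP) : ModalFormula AP := neg (or (neg φ) (neg ψ))

/-- Implication. -/
def imp (φ ψ : ModalFormula AP) : ModalFormula AP := or (neg φ) ψ

/-- Possibility, the dual of `box`. -/
def dia (φ : ModalFormula AP) : ModalFormula AP := neg (box (neg φ))

/-- Truth of a formula at a point of the Kripke model `(W, R, V)`. -/
def Sat {W : Type*} (R : W → W → Prop) (V : AP → Set W) : W → ModalFormula AP → Prop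
  | _, top => True
  | x, atom p => x ∈ V p
  | x, or φ ψ => Sat R V x φ ∨ Sat R V x ψ
  | x, neg φ => ¬ Sat R V x φ
  | x, box φ => ∀ y, R x y → Sat R V y φ

/-- Validity in the Kripke frame `(W, R)`: truth at every point under every valuation. -/
def ValidOn {W : Type*} (R : W → W → Prop) (φ : ModalFormula AP) : Prop :=
  ∀ (V : AP → Set W) (x : W), Sat R V x φ

/-- The after formula in the atoms `p₁`, `p₂`, `q`:
`◇(◇(p₁ ∧ ¬p₂ ∧ □¬p₂) ∧ ◇(p₂ ∧ ¬p₁ ∧ □¬p₁)) ∧ ◇q ⇒ ◇(◇p₁ ∧ ◇q) ∨ ◇(◇p₂ ∧ ◇q)`. -/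
def afterFormula (p₁ p₂ q : AP) : ModalFormula AP :=
  imp
    (and
      (dia (and
        (dia (and (atom p₁) (and (neg (atom p₂)) (box (neg (atom p₂))))))
        (dia (and (atom p₂) (and (neg (atom p₁)) (box (neg (atom p₁))))))))
      (dia (atom q)))
    (or
      (dia (and (dia (atom p₁)) (dia (atom q))))
      (dia (and (dia (atom p₂)) (dia (atom q)))))

end ModalFormula

/-! ### Smooth spacetimes -/

/-- The data making a smooth manifold `M` of dimension `1 + n` into a (smooth, time-oriented)
spacetime: a smooth metric of signature `(-, +, …, +)` and a continuous, everywhere timelike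
vector field, the time orientation. -/
structure Spacetime (n : ℕ) (M : Type*) [TopologicalSpace M]
    [ChartedSpace (EuclideanSpace ℝ (Fin (n + 1))) M] [IsManifold (𝓡 (n + 1)) ∞ M] where
  /-- The metric. -/
  g : ∀ x : M, TangentSpace (𝓡 (n + 1)) x →L[ℝ] TangentSpace (𝓡 (n + 1)) x →L[ℝ] ℝ
  symm : ∀ (x : M) (v w : TangentSpace (𝓡 (n + 1)) x), g x v w = g x w v
  /-- In a suitable basis `g x` is `diag(-1, 1, …, 1)`. -/
  lorentzian : ∀ x : M, ∃ b : Module.Basis (Fin (n + 1)) ℝ (TangentSpace (𝓡 (n + 1)) x),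
    ∀ i j, g x (b i) (b j) = if i = j then (if i = 0 then -1 else 1) else 0
  /-- The metric is a smooth section of the bundle of bilinear forms on the tangent spaces. -/
  smooth : ContMDiff (𝓡 (n + 1))
    ((𝓡 (n + 1)).prod 𝓘(ℝ, EuclideanSpace ℝ (Fin (n + 1)) →L[ℝ]
      EuclideanSpace ℝ (Fin (n + 1)) →L[ℝ] ℝ)) ∞
    (fun x : M ↦ Bundle.TotalSpace.mk' (E := fun x : M ↦
        TangentSpace (𝓡 (n + 1)) x →L[ℝ] TangentSpace (𝓡 (n + 1)) x →L[ℝ] ℝ)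
      (EuclideanSpace ℝ (Fin (n + 1)) →L[ℝ] EuclideanSpace ℝ (Fin (n + 1)) →L[ℝ] ℝ) x (g x))
  /-- The time orientation. -/
  T : ∀ x : M, TangentSpace (𝓡 (n + 1)) x
  continuous_T : Continuous (fun x : M ↦ (⟨x, T x⟩ : TangentBundle (𝓡 (n + 1)) M))
  timelike_T : ∀ x : M, g x (T x) (T x) < 0

namespace Spacetime

variable {n : ℕ} {M : Type*} [TopologicalSpace M]
  [ChartedSpace (EuclideanSpace ℝ (Fin (n + 1))) M] [IsManifold (𝓡 (n + 1)) ∞ M]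

/-- A tangent vector is causal if it is timelike or lightlike. -/
def IsCausal (S : Spacetime n M) {x : M} (v : TangentSpace (𝓡 (n + 1)) x) : Prop :=
  v ≠ 0 ∧ S.g x v v ≤ 0

/-- A tangent vector is future directed if its product with the time orientation is negative. -/
def IsFutureDirected (S : Spacetime n M) {x : M} (v : TangentSpace (𝓡 (n + 1)) x) : Prop :=
  S.g x (S.T x) v < 0

/-- `γ` is smooth on the closed interval `[a, b]`, and all its velocity vectors there (one-sided
at the end points) are future directed causal. -/
def IsSmoothCausalOn (S : Spacetime n M) (γ : ℝ → M) (a b : ℝ) : Prop :=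
  ContMDiffOn 𝓘(ℝ, ℝ) (𝓡 (n + 1)) ∞ γ (Set.Icc a b) ∧
    ∀ s ∈ Set.Icc a b,
      S.IsCausal (mfderivWithin 𝓘(ℝ, ℝ) (𝓡 (n + 1)) γ (Set.Icc a b) s 1) ∧
      S.IsFutureDirected (mfderivWithin 𝓘(ℝ, ℝ) (𝓡 (n + 1)) γ (Set.Icc a b) s 1)

/-- `γ : [a, b] → M`, with `a < b`, is a (piecewise smooth) causal curve: for some partition
`a = t 0 < t 1 < ⋯ < t k = b` it is smooth and future directed causal on each closed
subinterval. Neighbouring pieces share the value of `γ` at their common end point, so `γ` is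
continuous on `[a, b]`. -/
def IsCausalCurve (S : Spacetime n M) (γ : ℝ → M) (a b : ℝ) : Prop :=
  a < b ∧ ∃ (k : ℕ) (t : ℕ → ℝ), t 0 = a ∧ t k = b ∧
    ∀ i < k, t i < t (i + 1) ∧ S.IsSmoothCausalOn γ (t i) (t (i + 1))

/-- The after (strict causal) relation: there is a causal curve from `x` to `y`. -/
def After (S : Spacetime n M) (x y : M) : Prop :=
  ∃ (γ : ℝ → M) (a b : ℝ), S.IsCausalCurve γ a b ∧ γ a = x ∧ γ b = y

end Spacetime

open Set Filter Topology

/-! Let $z$ be after $x$, and let $y_1\ne y_2$ both be after $z$, neither after the other. The heart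
of the proof, `Spacetime.inner_or_inner`, is that $x$ then lies in the interior of the causal past
of $y_1$ or of $y_2$. This suffices: a causal curve from $x$ to a point satisfying $q$ stays in that
interior for some time, so an early point of it precedes both the $y_i$ in question and the
$q$-point (`Inner.exists_after`). The clauses on $p_1,p_2$ serve only to make $y_1,y_2$
incomparable.

Suppose that $x$ is in neither interior. Lying in the interior of a past propagates backwards along
causal curves (`Inner.of_reflTransGen`), so on the curves from $x$ through $z$ to $y_i$ no point is
interior to the past of a later one. This rigidity has two consequences. There are no corners, since
a short chord across a corner is timelike (`exists_eventually_link_of_not_sameRay`). Each smooth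
piece satisfies the geodesic equation up to parametrization, since otherwise a variation with fixed
ends makes a short part of it timelike (`exists_eventually_link_of_eulerLagrange_neg`). In both
cases the start of the timelike curve can be moved freely, which puts a point of the curve in the
interior of the past of a later one.

Unparametrized geodesics are determined by their initial point and direction: normalizing velocities
by a linear form turns them into integral curves of one $C^1$ vector field
(`LorentzPatch.exists_eq_and_sameRay`). Both curves leave $z$ in the direction in which the common
curve from $x$ arrives, so one runs along the other until its end (`Tight.exists_end_eq`,
`TightChain.comparable`), and $y_1,y_2$ would be comparable. -/

/-- A statement that holds near every point of a compact set, locally uniformly along a filter,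
holds eventually on the whole compact set. -/
theorem IsCompact.eventually_forall_of_eventually_prod {α β : Type*} [TopologicalSpace β]
    {l : Filter α} {K : Set β} (hK : IsCompact K) {P : α → β → Prop}
    (h : ∀ t ∈ K, ∀ᶠ q in l ×ˢ 𝓝[K] t, P q.1 q.2) : ∀ᶠ s in l, ∀ t ∈ K, P s t := by
  refine hK.induction_on (p := fun S ↦ ∀ᶠ s in l, ∀ t ∈ S, P s t) ?_ ?_ ?_ ?_
  · simp
  · intro S T hST hT
    filter_upwards [hT] with s hs t ht using hs t (hST ht)
  · intro S T hS hT
    filter_upwards [hS, hT] with s hs ht t htt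
    exact htt.elim (hs t) (ht t)
  · intro t ht
    obtain ⟨pa, ha, pb, hb, hab⟩ := eventually_prod_iff.1 (h t ht)
    exact ⟨{x | pb x}, hb, ha.mono fun s hs t ht ↦ hab hs ht⟩

/-! ### Variations of causal curves in a coordinate patch -/

section Patch

set_option synthInstance.maxHeartbeats 200000
set_option maxSynthPendingDepth 3

variable {E : Type*} [NormedAddCommGroup E] [NormedSpace ℝ E]

/-- A smooth Lorentzian metric `G` on an open subset `Ω` of a vector space, time oriented by a
constant vector `U`. -/
structure LorentzPatch (Ω : Set E) (G : E → E →L[ℝ] E →L[ℝ] ℝ) (U : E) : Prop where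
  isOpen : IsOpen Ω
  smooth : ContDiffOn ℝ ∞ G Ω
  symm : ∀ u ∈ Ω, ∀ v w, G u v w = G u w v
  timelike : ∀ u ∈ Ω, G u U U < 0
  pos : ∀ u ∈ Ω, ∀ d, G u U d = 0 → d ≠ 0 → 0 < G u d d

namespace LorentzPatch

/-- The bundle of future directed timelike vectors. -/
def timeCone (Ω : Set E) (G : E → E →L[ℝ] E →L[ℝ] ℝ) (U : E) : Set (E × E) :=
  {z | z.1 ∈ Ω ∧ G z.1 z.2 z.2 < 0 ∧ G z.1 U z.2 < 0}

/-- Smooth future directed causal curves in a patch. -/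
def CausalOn (Ω : Set E) (G : E → E →L[ℝ] E →L[ℝ] ℝ) (U : E) (c : ℝ → E) (a b : ℝ) : Prop :=
  ContDiffOn ℝ ∞ c (Icc a b) ∧ ∀ t ∈ Icc a b, c t ∈ Ω ∧
    G (c t) (derivWithin c (Icc a b) t) (derivWithin c (Icc a b) t) ≤ 0 ∧
    G (c t) U (derivWithin c (Icc a b) t) < 0

/-- Two points of a patch are linked if a smooth future directed causal curve joins them. -/
def Link (Ω : Set E) (G : E → E →L[ℝ] E →L[ℝ] ℝ) (U : E) (x y : E) : Prop :=
  ∃ (c : ℝ → E) (a b : ℝ), a < b ∧ CausalOn Ω G U c a b ∧ c a = x ∧ c b = y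

variable {Ω : Set E} {G : E → E →L[ℝ] E →L[ℝ] ℝ} {U : E}

theorem smul_mem_timeCone {u v : E} (hz : (u, v) ∈ timeCone Ω G U) {k : ℝ} (hk : 0 < k) :
    (u, k • v) ∈ timeCone Ω G U := by
  obtain ⟨h1, h2, h3⟩ := hz
  refine ⟨h1, ?_, ?_⟩
  · simp only [map_smul, smul_apply, smul_eq_mul] at h2 ⊢
    exact mul_neg_of_pos_of_neg hk (mul_neg_of_pos_of_neg hk h2)
  · simp only [map_smul, smul_eq_mul] at h3 ⊢
    exact mul_neg_of_pos_of_neg hk h3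

theorem contDiffAt_metric (h : LorentzPatch Ω G U) {u : E} (hu : u ∈ Ω) : ContDiffAt ℝ ∞ G u :=
  h.smooth.contDiffAt (h.isOpen.mem_nhds hu)

theorem contDiffAt_energy (h : LorentzPatch Ω G U) {z : E × E} (hz : z.1 ∈ Ω) :
    ContDiffAt ℝ ∞ (fun z : E × E ↦ G z.1 z.2 z.2) z :=
  (((h.contDiffAt_metric hz).comp z contDiffAt_fst).clm_apply contDiffAt_snd).clm_apply
    contDiffAt_snd

/-- Along a variation $V$ of a curve this is the integrand of the first variation of energy;
symmetry of the metric merges the two fibre terms. -/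
theorem fderiv_energy (h : LorentzPatch Ω G U) {u v : E} (hu : u ∈ Ω) (x y : E) :
    fderiv ℝ (fun z : E × E ↦ G z.1 z.2 z.2) (u, v) (x, y) =
      fderiv ℝ G u x v v + 2 * G u v y := by
  have hG : HasFDerivAt (fun z : E × E ↦ G z.1) ((fderiv ℝ G u).comp
      (ContinuousLinearMap.fst ℝ E E)) (u, v) :=
    HasFDerivAt.comp (u, v) (f := Prod.fst)
      ((h.contDiffAt_metric hu).differentiableAt (by simp)).hasFDerivAt hasFDerivAt_fst
  rw [((hG.clm_apply hasFDerivAt_snd).clm_apply hasFDerivAt_snd).fderiv]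
  simp [h.symm u hu y v]
  ring

theorem isOpen_timeCone (h : LorentzPatch Ω G U) : IsOpen (timeCone Ω G U) := by
  refine isOpen_iff_mem_nhds.2 fun z hz ↦ ?_
  have h1 : ContinuousAt (fun z : E × E ↦ G z.1 z.2 z.2) z := (h.contDiffAt_energy hz.1).continuousAt
  have h2 : ContinuousAt (fun z : E × E ↦ G z.1 U z.2) z :=
    (((h.contDiffAt_metric hz.1).continuousAt.comp (x := z) continuousAt_fst).clm_apply
      continuousAt_const).clm_apply continuousAt_snd
  filter_upwards [continuousAt_fst.eventually_mem (h.isOpen.mem_nhds hz.1),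
    h1.eventually_lt_const hz.2.1, h2.eventually_lt_const hz.2.2] with w hw1 hw2 hw3
  exact ⟨hw1, hw2, hw3⟩

theorem CausalOn.mono {c : ℝ → E} {a b a' b' : ℝ} (hc : CausalOn Ω G U c a b) (ha : a ≤ a')
    (hb : b' ≤ b) (hab : a' < b') : CausalOn Ω G U c a' b' := by
  have hsub : Icc a' b' ⊆ Icc a b := Icc_subset_Icc ha hb
  refine ⟨hc.1.mono hsub, fun t ht ↦ ?_⟩
  rw [derivWithin_subset hsub (uniqueDiffOn_Icc hab t ht)
    (hc.1.differentiableOn (by simp) t (hsub ht))]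
  exact hc.2 t (hsub ht)

theorem continuousOn_derivWithin_Icc {c : ℝ → E} {a b : ℝ} (hab : a < b)
    (hc : ContDiffOn ℝ ∞ c (Icc a b)) : ContinuousOn (derivWithin c (Icc a b)) (Icc a b) :=
  hc.continuousOn_derivWithin (uniqueDiffOn_Icc hab) (by simp)

/-- A variation that decreases the energy to first order turns a causal curve into a timelike
one. -/
theorem eventually_add_smul_mem_timeCone (h : LorentzPatch Ω G U) {c c' V V' : ℝ → E} {a b : ℝ}
    (hc : ContinuousOn c (Icc a b)) (hc' : ContinuousOn c' (Icc a b))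
    (hV : ContinuousOn V (Icc a b)) (hV' : ContinuousOn V' (Icc a b))
    (hcausal : ∀ t ∈ Icc a b, c t ∈ Ω ∧ G (c t) (c' t) (c' t) ≤ 0 ∧ G (c t) U (c' t) < 0)
    (hneg : ∀ t ∈ Icc a b,
      fderiv ℝ G (c t) (V t) (c' t) (c' t) + 2 * G (c t) (c' t) (V' t) < 0) :
    ∀ᶠ s in 𝓝[>] (0 : ℝ), ∀ t ∈ Icc a b, (c t + s • V t, c' t + s • V' t) ∈ timeCone Ω G U := by
  refine isCompact_Icc.eventually_forall_of_eventually_prod fun t₀ ht₀ ↦ ?_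
  set K := Icc a b
  obtain ⟨hΩ, -, hU⟩ := hcausal t₀ ht₀
  set f : E × E → ℝ := fun z ↦ G z.1 z.2 z.2 with hf
  set z₀ : E × E := (c t₀, c' t₀)
  set D := fderiv ℝ f z₀ with hD
  have hs : HasStrictFDerivAt f D z₀ := (h.contDiffAt_energy (z := z₀) hΩ).hasStrictFDerivAt (by simp)
  let l := 𝓝[>] (0 : ℝ) ×ˢ 𝓝[K] t₀
  have hl1 : Tendsto (fun q : ℝ × ℝ ↦ q.1) l (𝓝 0) := tendsto_fst.mono_right nhdsWithin_le_nhds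
  have hl2 : ∀ {f : ℝ → E}, ContinuousOn f K → Tendsto (fun q : ℝ × ℝ ↦ f q.2) l (𝓝 (f t₀)) :=
    fun hf ↦ (hf t₀ ht₀).tendsto.comp tendsto_snd
  have hz : Tendsto (fun q : ℝ × ℝ ↦ (c q.2, c' q.2)) l (𝓝 z₀) := (hl2 hc).prodMk_nhds (hl2 hc')
  have hζ : Tendsto (fun q : ℝ × ℝ ↦ (V q.2, V' q.2)) l (𝓝 (V t₀, V' t₀)) :=
    (hl2 hV).prodMk_nhds (hl2 hV')
  have hzs : Tendsto (fun q : ℝ × ℝ ↦ (c q.2, c' q.2) + q.1 • (V q.2, V' q.2)) l (𝓝 z₀) := by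
    simpa using hz.add (hl1.smul hζ)
  have hDneg : D (V t₀, V' t₀) < 0 := by
    rw [hD, hf, h.fderiv_energy hΩ]; exact hneg t₀ ht₀
  set δ := -D (V t₀, V' t₀) with hδ
  have hδ0 : 0 < δ := by simpa [hδ] using hDneg
  set R := ‖(V t₀, V' t₀)‖ + 1 with hR
  have hR0 : 0 < R := by positivity
  -- Strict differentiability makes the remainder uniform in the base point. With the constant `δ /
  -- (2 * R)` it is at most `s * (δ / 2)`, which the linear term, below `-s * (δ / 2)`, outweighs.
  have hbound := (hs.isLittleO.comp_tendsto (hzs.prodMk_nhds hz)).def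
    (c := δ / (2 * R)) (by positivity)
  have hDlim : Tendsto (fun q : ℝ × ℝ ↦ D (V q.2, V' q.2)) l (𝓝 (D (V t₀, V' t₀))) :=
    (D.continuous.tendsto _).comp hζ
  have hpos : ∀ᶠ q in l, 0 < q.1 := tendsto_fst.eventually self_mem_nhdsWithin
  have hmem : ∀ᶠ q in l, q.2 ∈ K := tendsto_snd.eventually self_mem_nhdsWithin
  have hU' : ContinuousAt (fun z : E × E ↦ G z.1 U z.2) z₀ :=
    (((h.contDiffAt_metric hΩ).continuousAt.comp (x := z₀) continuousAt_fst).clm_apply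
      continuousAt_const).clm_apply continuousAt_snd
  filter_upwards [hbound, hpos, hmem, hDlim.eventually_lt_const (u := -δ / 2) (by linarith),
    hζ.norm.eventually_lt_const (u := R) (by linarith),
    hzs.eventually (h.isOpen.preimage continuous_fst |>.mem_nhds hΩ),
    hzs.eventually (hU'.eventually_lt_const hU)] with q hq hq0 hqK hq1 hq2 hq3 hq4
  refine ⟨hq3, ?_, hq4⟩
  have h0 := (hcausal q.2 hqK).2.1
  have hle := (abs_le.1 (Real.norm_eq_abs _ ▸ hq)).2
  simp only [Function.comp_apply, add_sub_cancel_left, map_smul, norm_smul, Real.norm_eq_abs,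
    abs_of_pos hq0, smul_eq_mul] at hle
  have hprod : δ / (2 * R) * (q.1 * ‖(V q.2, V' q.2)‖) ≤ q.1 * (δ / 2) := by
    have : δ / (2 * R) * (q.1 * ‖(V q.2, V' q.2)‖) ≤ δ / (2 * R) * (q.1 * R) := by gcongr
    refine this.trans_eq ?_
    field_simp
  have hlast : q.1 * D (V q.2, V' q.2) < q.1 * (-δ / 2) := by gcongr
  have : f ((c q.2, c' q.2) + q.1 • (V q.2, V' q.2)) < 0 := by
    have : f (c q.2, c' q.2) ≤ 0 := h0
    linarith
  exact this

theorem CausalOn.eventually_variation (h : LorentzPatch Ω G U) {c V : ℝ → E} {a b : ℝ}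
    (hab : a < b) (hc : CausalOn Ω G U c a b) (hV : ContDiff ℝ ∞ V)
    (hneg : ∀ t ∈ Icc a b,
      fderiv ℝ G (c t) (V t) (derivWithin c (Icc a b) t) (derivWithin c (Icc a b) t) +
        2 * G (c t) (derivWithin c (Icc a b) t) (deriv V t) < 0) :
    ∀ᶠ s in 𝓝[>] (0 : ℝ), ContDiffOn ℝ ∞ (fun t ↦ c t + s • V t) (Icc a b) ∧
      ∀ t ∈ Icc a b, (c t + s • V t, derivWithin (fun t ↦ c t + s • V t) (Icc a b) t) ∈
        timeCone Ω G U := by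
  filter_upwards [h.eventually_add_smul_mem_timeCone hc.1.continuousOn
    (continuousOn_derivWithin_Icc hab hc.1) hV.continuous.continuousOn
    (hV.continuous_deriv (by simp)).continuousOn hc.2 hneg] with s hs
  refine ⟨hc.1.add (hV.contDiffOn.const_smul s), fun t ht ↦ ?_⟩
  have hd : HasDerivWithinAt (fun t ↦ c t + s • V t)
      (derivWithin c (Icc a b) t + s • deriv V t) (Icc a b) t :=
    (hc.1.differentiableOn (by simp) t ht).hasDerivWithinAt.add
      (((hV.differentiable (by simp) t).hasDerivAt.hasDerivWithinAt).const_smul s)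
  rw [hd.derivWithin (uniqueDiffOn_Icc hab t ht)]
  exact hs t ht

/-- A timelike curve stays causal under small perturbations. -/
theorem eventually_causalOn_add_smul (h : LorentzPatch Ω G U) {c : ℝ → E} {χ : ℝ → ℝ} {a b : ℝ}
    (hab : a < b) (hc : ContDiffOn ℝ ∞ c (Icc a b)) (hχ : ContDiff ℝ ∞ χ)
    (ht : ∀ t ∈ Icc a b, (c t, derivWithin c (Icc a b) t) ∈ timeCone Ω G U) :
    ∀ᶠ ξ in 𝓝 (0 : E), CausalOn Ω G U (fun t ↦ c t + χ t • ξ) a b := by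
  have key : ∀ᶠ ξ in 𝓝 (0 : E), ∀ t ∈ Icc a b,
      (c t + χ t • ξ, derivWithin c (Icc a b) t + deriv χ t • ξ) ∈ timeCone Ω G U := by
    refine isCompact_Icc.eventually_forall_of_eventually_prod fun t₀ ht₀ ↦ ?_
    have hl1 : Tendsto (fun q : E × ℝ ↦ q.1) (𝓝 0 ×ˢ 𝓝[Icc a b] t₀) (𝓝 0) := tendsto_fst
    have hl2 : ∀ {f : ℝ → E}, ContinuousOn f (Icc a b) →
        Tendsto (fun q : E × ℝ ↦ f q.2) (𝓝 0 ×ˢ 𝓝[Icc a b] t₀) (𝓝 (f t₀)) :=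
      fun hf ↦ (hf t₀ ht₀).tendsto.comp tendsto_snd
    have hl3 : ∀ {f : ℝ → ℝ}, Continuous f →
        Tendsto (fun q : E × ℝ ↦ f q.2) (𝓝 0 ×ˢ 𝓝[Icc a b] t₀) (𝓝 (f t₀)) :=
      fun hf ↦ (hf.continuousAt.mono_left nhdsWithin_le_nhds).comp tendsto_snd
    have h1 := (hl2 hc.continuousOn).add ((hl3 hχ.continuous).smul hl1)
    have h2 := (hl2 (continuousOn_derivWithin_Icc hab hc)).add
      ((hl3 (hχ.continuous_deriv (by simp))).smul hl1)
    simp only [smul_zero, add_zero] at h1 h2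
    exact (h1.prodMk_nhds h2).eventually (h.isOpen_timeCone.mem_nhds (ht t₀ ht₀))
  filter_upwards [key] with ξ hξ
  refine ⟨hc.add (hχ.contDiffOn.smul contDiffOn_const), fun t ht ↦ ?_⟩
  have hd : HasDerivWithinAt (fun t ↦ c t + χ t • ξ)
      (derivWithin c (Icc a b) t + deriv χ t • ξ) (Icc a b) t :=
    (hc.differentiableOn (by simp) t ht).hasDerivWithinAt.add
      (((hχ.differentiable (by simp) t).hasDerivAt.hasDerivWithinAt).smul_const ξ)
  rw [hd.derivWithin (uniqueDiffOn_Icc hab t ht)]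
  exact ⟨(hξ t ht).1, (hξ t ht).2.1.le, (hξ t ht).2.2⟩

/-- The displacement of the start is faded out linearly along the curve, so the end stays fixed. -/
theorem eventually_link_of_timelike (h : LorentzPatch Ω G U) {c : ℝ → E} {a b : ℝ}
    (hab : a < b) (hc : ContDiffOn ℝ ∞ c (Icc a b))
    (ht : ∀ t ∈ Icc a b, (c t, derivWithin c (Icc a b) t) ∈ timeCone Ω G U) :
    ∀ᶠ x in 𝓝 (c a), Link Ω G U x (c b) := by
  have hχ : ContDiff ℝ ∞ (fun t : ℝ ↦ (b - t) / (b - a)) :=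
    (contDiff_const.sub contDiff_id).div_const _
  have hlim : Tendsto (fun x ↦ x - c a) (𝓝 (c a)) (𝓝 0) := by
    simpa using (tendsto_id (x := 𝓝 (c a))).sub_const (c a)
  filter_upwards [hlim.eventually (h.eventually_causalOn_add_smul hab hc hχ ht)] with x hx
  refine ⟨_, a, b, hab, hx, ?_, ?_⟩
  · simp [div_self (sub_ne_zero.2 hab.ne')]
  · simp

/-- Here the whole curve is translated, so the end moves by the same small amount as the start. -/
theorem eventually_exists_link_of_timelike (h : LorentzPatch Ω G U) {c : ℝ → E} {a b : ℝ}
    (hab : a < b) (hc : ContDiffOn ℝ ∞ c (Icc a b))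
    (ht : ∀ t ∈ Icc a b, (c t, derivWithin c (Icc a b) t) ∈ timeCone Ω G U)
    {B : Set E} (hB : B ∈ 𝓝 (c b)) :
    ∀ᶠ x in 𝓝 (c a), ∃ y ∈ B, Link Ω G U x y := by
  have hlim : Tendsto (fun x ↦ x - c a) (𝓝 (c a)) (𝓝 0) := by
    simpa using (tendsto_id (x := 𝓝 (c a))).sub_const (c a)
  have hlim' : Tendsto (fun x ↦ c b + (x - c a)) (𝓝 (c a)) (𝓝 (c b)) := by
    simpa using hlim.const_add (c b)
  filter_upwards [hlim.eventually (h.eventually_causalOn_add_smul (χ := fun _ ↦ 1) hab hc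
    contDiff_const ht), hlim'.eventually hB] with x hx hxB
  exact ⟨_, hxB, _, a, b, hab, hx, by simp, by simp⟩

/-- Points near the start of a short causal curve precede points near its end. -/
theorem CausalOn.eventually_exists_link (h : LorentzPatch Ω G U) {c : ℝ → E} {a b : ℝ}
    (hab : a < b) (hc : CausalOn Ω G U c a b) :
    ∀ᶠ t in 𝓝[>] a, ∀ B ∈ 𝓝 (c t), ∀ᶠ x in 𝓝 (c a), ∃ y ∈ B, Link Ω G U x y := by
  set c' := derivWithin c (Icc a b) with hc'
  have haI : a ∈ Icc a b := left_mem_Icc.2 hab.le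
  obtain ⟨haΩ, -, haU⟩ := hc.2 a haI
  -- First variation for the field `(t - a) • U`, which fixes the start. At `a` only the term `2 * G
  -- (c a) (c' a) U < 0` survives, so by continuity it is negative on a short interval. The end
  -- moves by `s • (t - a) • U`, which stays in `B` for small `s`.
  have hcont : ContinuousOn (fun t ↦ fderiv ℝ G (c t) ((t - a) • U) (c' t) (c' t) +
      2 * G (c t) (c' t) U) (Icc a b) := by
    have h1 : ContinuousOn (fun t ↦ G (c t)) (Icc a b) :=
      h.smooth.continuousOn.comp hc.1.continuousOn fun t ht ↦ (hc.2 t ht).1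
    have h2 : ContinuousOn (fun t ↦ fderiv ℝ G (c t)) (Icc a b) :=
      (h.smooth.continuousOn_fderiv_of_isOpen h.isOpen (by simp)).comp hc.1.continuousOn
        fun t ht ↦ (hc.2 t ht).1
    have h3 := continuousOn_derivWithin_Icc hab hc.1
    have h4 : ContinuousOn (fun t : ℝ ↦ (t - a) • U) (Icc a b) := by fun_prop
    exact (((h2.clm_apply h4).clm_apply h3).clm_apply h3).add
      (continuousOn_const.mul ((h1.clm_apply h3).clm_apply continuousOn_const))
  have hneg : ∀ᶠ t in 𝓝[≥] a, t ≤ b ∧ fderiv ℝ G (c t) ((t - a) • U) (c' t) (c' t) +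
      2 * G (c t) (c' t) U < 0 := by
    rw [← nhdsWithin_Icc_eq_nhdsGE hab]
    filter_upwards [self_mem_nhdsWithin, (hcont a haI).eventually_lt_const
      (u := 0) (by
        have := mul_neg_of_pos_of_neg two_pos haU
        simpa [h.symm _ haΩ _ U, hc'] using this)] with t ht htn using ⟨ht.2, htn⟩
  obtain ⟨e, hae, he⟩ := mem_nhdsGE_iff_exists_Icc_subset.1 hneg
  filter_upwards [Ioc_mem_nhdsGT hae] with t ht B hB
  have htb : t ≤ b := (he ⟨ht.1.le, ht.2⟩).1
  have hV : ContDiff ℝ ∞ (fun t : ℝ ↦ (t - a) • U) := by fun_prop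
  have hct := hc.mono le_rfl htb ht.1
  have hvar := hct.eventually_variation h ht.1 hV fun r hr ↦ by
    have hrb : r ∈ Icc a b := ⟨hr.1, hr.2.trans htb⟩
    rw [derivWithin_subset (Icc_subset_Icc_right htb) (uniqueDiffOn_Icc ht.1 r hr)
      (hc.1.differentiableOn (by simp) r hrb)]
    have hd : HasDerivAt (fun t : ℝ ↦ (t - a) • U) ((1 : ℝ) • U) r :=
      ((hasDerivAt_id r).sub_const a).smul_const U
    rw [hd.deriv, one_smul]
    exact (he ⟨hr.1, hr.2.trans ht.2⟩).2
  have hend : ∀ᶠ s in 𝓝[>] (0 : ℝ), B ∈ 𝓝 (c t + s • (t - a) • U) := by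
    have : Tendsto (fun s : ℝ ↦ c t + s • (t - a) • U) (𝓝[>] 0) (𝓝 (c t)) := by
      have : Continuous (fun s : ℝ ↦ c t + s • (t - a) • U) := by fun_prop
      simpa using (this.tendsto 0).mono_left nhdsWithin_le_nhds
    exact this.eventually (eventually_mem_nhds_iff.2 hB)
  obtain ⟨s, ⟨hs1, hs2⟩, hs3⟩ := (hvar.and hend).exists
  simpa using h.eventually_exists_link_of_timelike ht.1 hs1 hs2 hs3

/-- Two future directed causal vectors that are not parallel add up to a timelike vector. -/
theorem add_mem_timeCone (h : LorentzPatch Ω G U) {u v w : E} (hu : u ∈ Ω)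
    (hv : G u v v ≤ 0) (hvU : G u U v < 0) (hw : G u w w ≤ 0) (hwU : G u U w < 0)
    (hray : ¬ SameRay ℝ v w) : (u, v + w) ∈ timeCone Ω G U := by
  -- This `l` makes `v - l • w` orthogonal to `U`. Positivity of its square then forces `G u v w <
  -- 0`, the reverse Cauchy–Schwarz effect.
  have hl : 0 < G u U v / G u U w := div_pos_of_neg_of_neg hvU hwU
  set l := G u U v / G u U w with hldef
  have hd : v - l • w ≠ 0 := fun h0 ↦ hray (by
    rw [sub_eq_zero.1 h0]
    exact SameRay.sameRay_pos_smul_left w hl)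
  have hd0 : G u U (v - l • w) = 0 := by
    simp only [map_sub, map_smul, smul_eq_mul, hldef]
    field_simp [hwU.ne]
    ring
  have hp := h.pos u hu _ hd0 hd
  simp only [map_sub, map_smul, smul_eq_mul, sub_apply,
    smul_apply, h.symm u hu w v] at hp
  have hvw : G u v w < 0 := by
    by_contra hcon
    nlinarith [mul_nonneg hl.le (not_lt.1 hcon), mul_nonneg (mul_nonneg hl.le hl.le) (neg_nonneg.2 hw)]
  refine ⟨hu, ?_, ?_⟩
  · simp only [map_add, add_apply, h.symm u hu w v]
    linarith
  · simp only [map_add]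
    linarith

/-- A corner of a causal curve can be cut. -/
theorem exists_eventually_link_of_not_sameRay (h : LorentzPatch Ω G U) {c d : ℝ → E}
    {a b a' b' : ℝ} (hab : a < b) (hab' : a' < b') (hc : CausalOn Ω G U c a b)
    (hd : CausalOn Ω G U d a' b') (hcd : c b = d a')
    (hray : ¬ SameRay ℝ (derivWithin c (Icc a b) b) (derivWithin d (Icc a' b') a')) :
    ∃ t ∈ Ico a b, ∃ s ∈ Ioc a' b', ∀ᶠ x in 𝓝 (c t), Link Ω G U x (d s) := by
  have hbI : b ∈ Icc a b := right_mem_Icc.2 hab.le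
  have haI : a' ∈ Icc a' b' := left_mem_Icc.2 hab'.le
  obtain ⟨hbΩ, hb1, hb2⟩ := hc.2 b hbI
  obtain ⟨-, ha1, ha2⟩ := hd.2 a' haI
  rw [← hcd] at ha1 ha2
  set v := derivWithin c (Icc a b) b
  set w := derivWithin d (Icc a' b') a'
  have hcone : (c b, v + w) ∈ timeCone Ω G U := h.add_mem_timeCone hbΩ hb1 hb2 ha1 ha2 hray
  have hmapc : Tendsto (fun ε : ℝ ↦ b - ε) (𝓝[>] 0) (𝓝[Icc a b \ {b}] b) := by
    refine tendsto_nhdsWithin_iff.2 ⟨?_, ?_⟩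
    · have : Continuous (fun ε : ℝ ↦ b - ε) := by fun_prop
      simpa using (this.tendsto 0).mono_left nhdsWithin_le_nhds
    · filter_upwards [Ioo_mem_nhdsGT (sub_pos.2 hab)] with ε hε
      refine ⟨⟨by linarith [hε.2], by linarith [hε.1]⟩, ?_⟩
      simpa using hε.1.ne'
  have hmapd : Tendsto (fun ε : ℝ ↦ a' + ε) (𝓝[>] 0) (𝓝[Icc a' b' \ {a'}] a') := by
    refine tendsto_nhdsWithin_iff.2 ⟨?_, ?_⟩
    · have : Continuous (fun ε : ℝ ↦ a' + ε) := by fun_prop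
      simpa using (this.tendsto 0).mono_left nhdsWithin_le_nhds
    · filter_upwards [Ioo_mem_nhdsGT (sub_pos.2 hab')] with ε hε
      refine ⟨⟨by linarith [hε.1], by linarith [hε.2]⟩, ?_⟩
      simpa using hε.1.ne'
  have hcd' := (hc.1.differentiableOn (by simp) b hbI).hasDerivWithinAt
  have hdd' := (hd.1.differentiableOn (by simp) a' haI).hasDerivWithinAt
  have hsc := (hasDerivWithinAt_iff_tendsto_slope.1 hcd').comp hmapc
  have hsd := (hasDerivWithinAt_iff_tendsto_slope.1 hdd').comp hmapd
  -- The chord from `c (b - ε)` to `d (a' + ε)`, divided by `ε`, tends to the sum of the two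
  -- velocities at the corner, which is timelike.
  have hdir : Tendsto (fun ε : ℝ ↦ ε⁻¹ • (d (a' + ε) - c (b - ε))) (𝓝[>] 0) (𝓝 (v + w)) := by
    refine (hsc.add hsd).congr fun ε ↦ ?_
    simp only [Function.comp_apply, slope, vsub_eq_sub, sub_sub_cancel_left, add_sub_cancel_left,
      inv_neg, neg_smul, ← smul_neg, ← smul_add, hcd]
    congr 1
    abel
  have hc0 : Tendsto (fun ε : ℝ ↦ c (b - ε)) (𝓝[>] 0) (𝓝 (c b)) :=
    ((hc.1.continuousOn b hbI).mono sdiff_subset).tendsto.comp hmapc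
  have hd0 : Tendsto (fun ε : ℝ ↦ d (a' + ε)) (𝓝[>] 0) (𝓝 (c b)) := by
    rw [hcd]
    exact ((hd.1.continuousOn a' haI).mono sdiff_subset).tendsto.comp hmapd
  have key : ∀ᶠ ε in 𝓝[>] (0 : ℝ), ∀ r ∈ Icc (0 : ℝ) 1,
      (c (b - ε) + r • (d (a' + ε) - c (b - ε)), ε⁻¹ • (d (a' + ε) - c (b - ε))) ∈
        timeCone Ω G U := by
    refine isCompact_Icc.eventually_forall_of_eventually_prod fun r _ ↦ ?_
    have hr : Tendsto (fun q : ℝ × ℝ ↦ q.2) (𝓝[>] 0 ×ˢ 𝓝[Icc (0 : ℝ) 1] r) (𝓝 r) :=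
      tendsto_snd.mono_right nhdsWithin_le_nhds
    have h1 := (hc0.comp (tendsto_fst (g := 𝓝[Icc (0 : ℝ) 1] r))).add
      (hr.smul ((hd0.sub hc0).comp tendsto_fst))
    simp only [sub_self, smul_zero, add_zero] at h1
    exact (h1.prodMk_nhds (hdir.comp tendsto_fst)).eventually
      (h.isOpen_timeCone.mem_nhds hcone)
  obtain ⟨ε, ⟨⟨hε, hεc⟩, hεd⟩, hε0⟩ := (((key.and (hmapc.eventually self_mem_nhdsWithin)).and
    (hmapd.eventually self_mem_nhdsWithin)).and self_mem_nhdsWithin).exists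
  have hε0 : (0 : ℝ) < ε := hε0
  refine ⟨b - ε, ⟨hεc.1.1, by linarith⟩, a' + ε, ⟨by linarith, hεd.1.2⟩, ?_⟩
  set Δ := d (a' + ε) - c (b - ε) with hΔ
  have hsm : ContDiff ℝ ∞ (fun r : ℝ ↦ c (b - ε) + r • Δ) := by fun_prop
  have := h.eventually_link_of_timelike (c := fun r : ℝ ↦ c (b - ε) + r • Δ) zero_lt_one
    hsm.contDiffOn fun r hr ↦ by
      have hder : HasDerivAt (fun r : ℝ ↦ c (b - ε) + r • Δ) ((1 : ℝ) • Δ) r :=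
        ((hasDerivAt_id r).smul_const Δ).const_add _
      rw [hder.hasDerivWithinAt.derivWithin (uniqueDiffOn_Icc zero_lt_one r hr), one_smul]
      have := smul_mem_timeCone (hε r hr) hε0
      rwa [smul_smul, mul_inv_cancel₀ hε0.ne', one_smul] at this
  simpa [hΔ] using this

/-- The usual integration by parts makes only the integral of the first variation negative, whereas
a timelike curve needs it negative at every parameter. The freedom to add a multiple of `U` to the
field `w` is used to spread the negativity evenly, and a factor vanishing at `t₀ ± ε` keeps the ends
fixed. -/
theorem exists_eventually_link_of_eulerLagrange_neg (h : LorentzPatch Ω G U) {c : ℝ → E}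
    {a b t₀ : ℝ} (hc : CausalOn Ω G U c a b) (ht₀ : t₀ ∈ Ioo a b) {w : E}
    (hw : G (c t₀) (deriv c t₀) w = 0)
    (hA : fderiv ℝ G (c t₀) w (deriv c t₀) (deriv c t₀) -
      2 * fderiv ℝ G (c t₀) (deriv c t₀) (deriv c t₀) w -
      2 * G (c t₀) (deriv (deriv c) t₀) w = -1) :
    ∃ t₁ ∈ Icc a b, ∃ t₂ ∈ Icc a b, t₁ < t₂ ∧ ∀ᶠ x in 𝓝 (c t₁), Link Ω G U x (c t₂) := by
  have hcd : ∀ t ∈ Ioo a b, ContDiffAt ℝ ∞ c t := fun t ht ↦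
    hc.1.contDiffAt (Icc_mem_nhds ht.1 ht.2)
  have hder : ∀ t ∈ Ioo a b, HasDerivAt c (deriv c t) t := fun t ht ↦
    ((hcd t ht).differentiableAt (by simp)).hasDerivAt
  have hder2 : HasDerivAt (deriv c) (deriv (deriv c) t₀) t₀ :=
    (((hcd t₀ ht₀).derivWithin (m := ∞) (by simp)).differentiableAt (by simp)).hasDerivAt
  have hdW : ∀ t ∈ Ioo a b, derivWithin c (Icc a b) t = deriv c t := fun t ht ↦
    derivWithin_of_mem_nhds (Icc_mem_nhds ht.1 ht.2)
  obtain ⟨hΩ, -, hU⟩ := hc.2 t₀ (Ioo_subset_Icc_self ht₀)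
  rw [hdW t₀ ht₀, h.symm _ hΩ] at hU
  set v := deriv c t₀ with hv
  set q := 2 * fderiv ℝ G (c t₀) v v w + 2 * G (c t₀) (deriv (deriv c) t₀) w with hq
  set X := (1 / (2 * G (c t₀) v U)) • U with hX
  have hvX : 2 * G (c t₀) v X = 1 := by
    simp only [hX, map_smul, smul_eq_mul]
    field_simp [hU.ne]
  set β := 1 / 3 - q with hβ
  set W : ℝ → E := fun t ↦ w + (t - t₀) • β • X with hW
  have hWd : ∀ t, HasDerivAt W (β • X) t := fun t ↦ by
    exact ((((hasDerivAt_id t).sub_const t₀).smul_const (β • X)).const_add w).congr_deriv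
      (one_smul ℝ _)
  have hW0 : W t₀ = w := by simp [hW]
  have hGd : HasDerivAt (fun t ↦ G (c t)) (fderiv ℝ G (c t₀) v) t₀ :=
    ((h.contDiffAt_metric hΩ).differentiableAt (by simp)).hasFDerivAt.comp_hasDerivAt t₀
      (hder t₀ ht₀)
  have hm : HasDerivAt (fun t ↦ 2 * G (c t) (deriv c t) (W t)) (1 / 3) t₀ := by
    refine (((hGd.clm_apply hder2).clm_apply (hWd t₀)).const_mul 2).congr_deriv ?_
    simp only [hW0, add_apply, map_smul, smul_eq_mul]
    linear_combination β * hvX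
  have hcc : ContinuousAt c t₀ := (hder t₀ ht₀).continuousAt
  have hk : ContinuousAt (fun t ↦ β * (2 * G (c t) (deriv c t) X) +
      fderiv ℝ G (c t) (W t) (deriv c t) (deriv c t)) t₀ := by
    have h1 : ContinuousAt (fun t ↦ fderiv ℝ G (c t)) t₀ :=
      ((h.contDiffAt_metric hΩ).continuousAt_fderiv (by simp)).comp hcc
    exact (((hGd.continuousAt.clm_apply hder2.continuousAt).clm_apply
      continuousAt_const).const_mul 2 |>.const_mul β).add
      (((h1.clm_apply (hWd t₀).continuousAt).clm_apply hder2.continuousAt).clm_apply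
        hder2.continuousAt)
  have hk0 : β * (2 * G (c t₀) (deriv c t₀) X) +
      fderiv ℝ G (c t₀) (W t₀) (deriv c t₀) (deriv c t₀) < -1 / 3 := by
    rw [hW0, ← hv, hvX]
    linarith
  have hev : ∀ᶠ t in 𝓝 t₀, (t - t₀) ^ 2 / 6 ≤ (t - t₀) * (2 * G (c t) (deriv c t) (W t)) := by
    have := hm.isLittleO.def (c := 1 / 6) (by norm_num)
    filter_upwards [this] with t ht
    simp only [hW0, ← hv, hw, mul_zero, sub_zero, smul_eq_mul, Real.norm_eq_abs] at ht
    have h2 := mul_le_mul_of_nonneg_left ht (abs_nonneg (t - t₀))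
    rw [← abs_mul] at h2
    have h3 := (abs_le.1 (h2.trans_eq (by rw [mul_left_comm, ← sq, sq_abs]))).1
    linarith
  obtain ⟨ε, hε, hball⟩ := Metric.nhds_basis_closedBall.eventually_iff.1
    ((hev.and (hk.eventually_lt_const hk0)).and (Ioo_mem_nhds ht₀.1 ht₀.2))
  rw [Real.closedBall_eq_Icc] at hball
  have hlt : t₀ - ε < t₀ + ε := by linarith
  have hI1 := (hball (left_mem_Icc.2 hlt.le)).2
  have hI2 := (hball (right_mem_Icc.2 hlt.le)).2
  refine ⟨t₀ - ε, Ioo_subset_Icc_self hI1, t₀ + ε, Ioo_subset_Icc_self hI2, hlt, ?_⟩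
  -- With `η = ((t - t₀) / ε) ^ 2`, the derivative of the cutoff contributes at most `-η / 3` and
  -- the rest at most `-(1 - η) / 3`, so the first variation is at most `-1 / 3` everywhere.
  set V : ℝ → E := fun t ↦ (1 - ((t - t₀) / ε) ^ 2) • W t with hV
  have hVs : ContDiff ℝ ∞ V := by
    have : ContDiff ℝ ∞ W := by fun_prop
    have h2 : ContDiff ℝ ∞ (fun t : ℝ ↦ 1 - ((t - t₀) / ε) ^ 2) :=
      contDiff_const.sub (((contDiff_id.sub contDiff_const).div_const _).pow 2)
    exact h2.smul this
  have hVd : ∀ t, HasDerivAt V ((1 - ((t - t₀) / ε) ^ 2) • β • X +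
      (-(2 * (t - t₀) / ε ^ 2)) • W t) t := fun t ↦ by
    have h1 : HasDerivAt (fun t : ℝ ↦ 1 - ((t - t₀) / ε) ^ 2) (-(2 * (t - t₀) / ε ^ 2)) t := by
      refine (((((hasDerivAt_id t).sub_const t₀).div_const ε).pow 2).const_sub 1).congr_deriv ?_
      simp only [id]
      field_simp
      push_cast
      field_simp
    exact h1.smul (hWd t)
  have hvar := (hc.mono hI1.1.le hI2.2.le hlt).eventually_variation h hlt hVs fun t ht ↦ by
    obtain ⟨⟨ht1, ht2⟩, ht3⟩ := hball ht
    rw [(hder t ht3).hasDerivWithinAt.derivWithin (uniqueDiffOn_Icc hlt t ht), (hVd t).deriv]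
    have hh : ((t - t₀) / ε) ^ 2 ≤ 1 := by
      rw [sq_le_one_iff_abs_le_one, abs_div, abs_of_pos hε, div_le_one hε, abs_le]
      exact ⟨by linarith [ht.1], by linarith [ht.2]⟩
    set η := ((t - t₀) / ε) ^ 2 with hη
    have e1 : 2 * (t - t₀) / ε ^ 2 * (2 * G (c t) (deriv c t) (W t)) ≥ η / 3 := by
      have : 2 / ε ^ 2 * ((t - t₀) ^ 2 / 6) ≤
          2 / ε ^ 2 * ((t - t₀) * (2 * G (c t) (deriv c t) (W t))) := by gcongr
      calc η / 3 = 2 / ε ^ 2 * ((t - t₀) ^ 2 / 6) := by rw [hη]; field_simp; ring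
        _ ≤ _ := this
        _ = _ := by ring
    have e2 : (1 - η) * (β * (2 * G (c t) (deriv c t) X) +
        fderiv ℝ G (c t) (W t) (deriv c t) (deriv c t)) ≤ (1 - η) * (-1 / 3) :=
      mul_le_mul_of_nonneg_left ht2.le (by linarith)
    simp only [hV, map_smul, map_add, smul_apply, smul_eq_mul]
    linarith
  obtain ⟨s, hs1, hs2⟩ := hvar.exists
  have := h.eventually_link_of_timelike hlt hs1 hs2
  have hz1 : V (t₀ - ε) = 0 := by simp [hV, neg_div, div_self hε.ne']
  have hz2 : V (t₀ + ε) = 0 := by simp [hV, div_self hε.ne']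
  simpa [hz1, hz2] using this

/-- A causal curve in a patch that cannot be deformed to a timelike one satisfies the geodesic
equation, up to a multiple of its velocity. -/
theorem eulerLagrange_eq_zero (h : LorentzPatch Ω G U) {c : ℝ → E} {a b : ℝ}
    (hc : CausalOn Ω G U c a b)
    (hno : ∀ t₁ ∈ Icc a b, ∀ t₂ ∈ Icc a b, t₁ < t₂ → ¬ ∀ᶠ x in 𝓝 (c t₁), Link Ω G U x (c t₂))
    {t₀ : ℝ} (ht₀ : t₀ ∈ Ioo a b) {w : E} (hw : G (c t₀) (deriv c t₀) w = 0) :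
    fderiv ℝ G (c t₀) w (deriv c t₀) (deriv c t₀) -
      2 * fderiv ℝ G (c t₀) (deriv c t₀) (deriv c t₀) w -
      2 * G (c t₀) (deriv (deriv c) t₀) w = 0 := by
  by_contra hA
  set A := fderiv ℝ G (c t₀) w (deriv c t₀) (deriv c t₀) -
      2 * fderiv ℝ G (c t₀) (deriv c t₀) (deriv c t₀) w -
      2 * G (c t₀) (deriv (deriv c) t₀) w with hAdef
  -- The expression is linear in `w`, so the factor `-A⁻¹` normalizes it to `-1`.
  obtain ⟨t₁, h₁, t₂, h₂, hlt, hl⟩ := h.exists_eventually_link_of_eulerLagrange_neg hc ht₀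
    (w := (-A⁻¹) • w) (by simp [hw]) (by
      simp only [map_smul, smul_apply, smul_eq_mul]
      field_simp
      linarith)
  exact hno t₁ h₁ t₂ h₂ hlt hl

end LorentzPatch

end Patch

/-! ### Uniqueness of integral curves up to parametrization -/

/-- A solution of the differential equation up to the left end point of an interval, excluded, has
a right derivative there. -/
theorem hasDerivWithinAt_Ici_of_hasDerivAt_Ioo {X : Type*} [NormedAddCommGroup X] [NormedSpace ℝ X]
    {y y' : ℝ → X} {a b : ℝ} (hab : a < b) (hy : ContinuousOn y (Icc a b))
    (hy' : ContinuousOn y' (Icc a b)) (hd : ∀ t ∈ Ioo a b, HasDerivAt y (y' t) t) :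
    ∀ t ∈ Ico a b, HasDerivWithinAt y (y' t) (Ici t) t := by
  intro t ht
  rcases ht.1.eq_or_lt with rfl | hat
  · refine hasDerivWithinAt_Ici_of_tendsto_deriv (s := Ioo a b)
      (fun t ht ↦ (hd t ht).differentiableAt.differentiableWithinAt)
      ((hy a (left_mem_Icc.2 hab.le)).mono Ioo_subset_Icc_self) (Ioo_mem_nhdsGT hab) ?_
    have h1 : Tendsto y' (𝓝[>] a) (𝓝 (y' a)) := by
      rw [← nhdsWithin_Ioo_eq_nhdsGT hab]
      exact (hy' a (left_mem_Icc.2 hab.le)).mono Ioo_subset_Icc_self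
    refine h1.congr' ?_
    filter_upwards [Ioo_mem_nhdsGT hab] with t ht using (hd t ht).deriv.symm
  · exact (hd t ⟨hat, ht.2⟩).hasDerivWithinAt

/-- A solution of `y' = θ' • F y` is a reparametrization of the integral curve of `F`. -/
theorem eventually_eq_integralCurve_comp {X : Type*} [NormedAddCommGroup X] [NormedSpace ℝ X]
    {F : X → X} {W y : ℝ → X} {θ r : ℝ → ℝ} {a b ε : ℝ} (hab : a < b) (hε : 0 < ε)
    (hF : ContDiffAt ℝ 1 F (y a)) (hW0 : W 0 = y a)
    (hW : ∀ t ∈ Ioo (-ε) ε, HasDerivAt W (F (W t)) t)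
    (hy : ContinuousOn y (Icc a b)) (hθ : ContinuousOn θ (Icc a b)) (hr : ContinuousOn r (Icc a b))
    (hθa : θ a = 0) (hyd : ∀ t ∈ Ioo a b, HasDerivAt y (r t • F (y t)) t)
    (hθd : ∀ t ∈ Ioo a b, HasDerivAt θ (r t) t) :
    ∃ e ∈ Ioc a b, ∀ t ∈ Icc a e, y t = W (θ t) := by
  obtain ⟨K, S, hS, hK⟩ := hF.exists_lipschitzOnWith
  have haI : a ∈ Icc a b := left_mem_Icc.2 hab.le
  have hcont : ∀ᶠ x in 𝓝 (y a), ContinuousAt F x := by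
    filter_upwards [hF.eventually (by simp)] with x hx using hx.continuousAt
  obtain ⟨O, hOsub, hO, haO⟩ := mem_nhds_iff.1 (inter_mem hS hcont)
  have hWc : ∀ t ∈ Ioo (-ε) ε, ContinuousAt W t := fun t ht ↦ (hW t ht).continuousAt
  have h0 : (0 : ℝ) ∈ Ioo (-ε) ε := ⟨by linarith, hε⟩
  have hθ0 : Tendsto θ (𝓝[Icc a b] a) (𝓝 0) := hθa ▸ hθ a haI
  have hev : ∀ᶠ t in 𝓝[≥] a, t ∈ Icc a b ∧ y t ∈ O ∧ θ t ∈ Ioo (-ε) ε ∧ W (θ t) ∈ O ∧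
      |r t| < |r a| + 1 := by
    rw [← nhdsWithin_Icc_eq_nhdsGE hab]
    filter_upwards [self_mem_nhdsWithin, (hy a haI).eventually_mem (hO.mem_nhds haO),
      hθ0.eventually_mem (Ioo_mem_nhds h0.1 h0.2),
      (((hWc 0 h0).tendsto.comp hθ0).eventually_mem (hO.mem_nhds (hW0 ▸ haO))),
      (hr a haI).abs.tendsto.eventually_lt_const (lt_add_one _)] with t h1 h2 h3 h4 h5
    exact ⟨h1, h2, h3, h4, h5⟩
  obtain ⟨e, hae, he⟩ := mem_nhdsGE_iff_exists_Icc_subset.1 hev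
  have hae : a < e := hae
  have heb : e ≤ b := (he (right_mem_Icc.2 hae.le)).1.2
  have hsub : Icc a e ⊆ Icc a b := Icc_subset_Icc_right heb
  have hFc : ∀ {x}, x ∈ O → ContinuousAt F x := fun hx ↦ (hOsub hx).2
  have hWθ : ContinuousOn (fun t ↦ W (θ t)) (Icc a e) := fun t ht ↦
    (hWc _ (he ht).2.2.1).comp_continuousWithinAt (hθ.mono hsub t ht)
  refine ⟨e, ⟨hae, heb⟩, ?_⟩
  -- Both `y` and `W ∘ θ` solve `z' = r t • F z` with the same initial value; on `[a, e]` the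
  -- right-hand side is Lipschitz in `z` with constant `(|r a| + 1) * K`.
  refine ODE_solution_unique_of_mem_Icc_right (v := fun t z ↦ r t • F z) (s := fun _ ↦ O)
    (K := (|r a| + 1).toNNReal * K) ?_ (hy.mono hsub) ?_ (fun t ht ↦ ?_) hWθ ?_
    (fun t ht ↦ ?_) (by simp [hθa, hW0])
  · intro t ht
    refine LipschitzOnWith.of_dist_le_mul fun x hx z hz ↦ ?_
    rw [dist_eq_norm, ← smul_sub, norm_smul, Real.norm_eq_abs, NNReal.coe_mul, mul_assoc,
      ← dist_eq_norm, Real.coe_toNNReal _ (by positivity)]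
    exact mul_le_mul (he (Ico_subset_Icc_self ht)).2.2.2.2.le
      (hK.dist_le_mul x (hOsub hx).1 z (hOsub hz).1) dist_nonneg
      (by positivity)
  · refine hasDerivWithinAt_Ici_of_hasDerivAt_Ioo hae (hy.mono hsub) ?_
      fun t ht ↦ hyd t ⟨ht.1, ht.2.trans_le heb⟩
    exact (hr.mono hsub).smul fun t ht ↦
      (hFc (he ht).2.1).comp_continuousWithinAt (hy.mono hsub t ht)
  · exact (he (Ico_subset_Icc_self ht)).2.1
  · refine hasDerivWithinAt_Ici_of_hasDerivAt_Ioo hae hWθ ?_ fun t ht ↦ ?_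
    · exact (hr.mono hsub).smul fun t ht ↦
        (hFc (he ht).2.2.2.1).comp_continuousWithinAt (f := fun t ↦ W (θ t)) (hWθ t ht)
    · exact HasDerivAt.scomp t (hW _ (he (Ioo_subset_Icc_self ht)).2.2.1)
        (hθd t ⟨ht.1, ht.2.trans_le heb⟩)
  · exact (he (Ico_subset_Icc_self ht)).2.2.2.1

/-! ### Unparametrized geodesics as integral curves -/

section Patch

set_option synthInstance.maxHeartbeats 200000
set_option maxSynthPendingDepth 3

variable {E : Type*} [NormedAddCommGroup E] [NormedSpace ℝ E]

namespace LorentzPatch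

/-- Twice the covector `G(c'', ·)` along a geodesic through `u` with velocity `v`. -/
noncomputable def force (G : E → E →L[ℝ] E →L[ℝ] ℝ) (z : E × E) : E →L[ℝ] ℝ :=
  ((fderiv ℝ G z.1).flip z.2).flip z.2 - (2 : ℝ) • fderiv ℝ G z.1 z.2 z.2

/-- The acceleration of the geodesic through `u` with velocity `v`. -/
noncomputable def accel (G : E → E →L[ℝ] E →L[ℝ] ℝ) (z : E × E) : E :=
  (1 / 2 : ℝ) • (G z.1).inverse (force G z)

/-- The vector field of unparametrized geodesics, normalized by the linear form `τ`. -/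
noncomputable def directionField (G : E → E →L[ℝ] E →L[ℝ] ℝ) (τ : E →L[ℝ] ℝ) (z : E × E) : E × E :=
  (z.2, accel G z - τ (accel G z) • z.2)

variable {Ω : Set E} {G : E → E →L[ℝ] E →L[ℝ] ℝ} {U : E}

/-- Homogeneity of degree two permits passing from a velocity to its normalization. -/
theorem accel_smul (u v : E) (r : ℝ) : accel G (u, r • v) = r ^ 2 • accel G (u, v) := by
  have : force G (u, r • v) = r ^ 2 • force G (u, v) := by
    ext w
    simp only [force, sub_apply, smul_apply, map_smul, ContinuousLinearMap.flip_apply, smul_eq_mul]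
    ring
  simp only [accel, this, map_smul]
  rw [smul_comm]

/-- A vector in the kernel is orthogonal to `U` and has square zero, so positivity on the complement
of `U` makes it vanish. -/
theorem isInvertible_metric [FiniteDimensional ℝ E] (h : LorentzPatch Ω G U) {u : E}
    (hu : u ∈ Ω) : (G u).IsInvertible := by
  have hinj : Function.Injective (G u) := by
    refine (injective_iff_map_eq_zero _).2 fun v hv ↦ ?_
    by_contra hv0
    have h1 : G u U v = 0 := by rw [h.symm u hu, hv]; rfl
    have h2 := h.pos u hu v h1 hv0
    rw [hv] at h2
    simp at h2
  have hfin : Module.finrank ℝ E = Module.finrank ℝ (E →L[ℝ] ℝ) := by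
    rw [← (LinearMap.toContinuousLinearMap (𝕜 := ℝ) (E := E) (F' := ℝ)).finrank_eq]
    exact (Subspace.dual_finrank_eq (K := ℝ) (V := E)).symm
  exact ⟨(LinearMap.linearEquivOfInjective (G u : E →ₗ[ℝ] (E →L[ℝ] ℝ)) hinj
    hfin).toContinuousLinearEquiv, by ext; rfl⟩

theorem contDiffAt_accel [FiniteDimensional ℝ E] (h : LorentzPatch Ω G U) {z : E × E}
    (hz : z.1 ∈ Ω) : ContDiffAt ℝ 1 (accel G) z := by
  have : CompleteSpace E := FiniteDimensional.complete ℝ E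
  have hG := h.contDiffAt_metric hz
  have h1 : ContDiffAt ℝ 1 (fun z : E × E ↦ fderiv ℝ G z.1) z :=
    (hG.fderiv_right (m := 1) (WithTop.coe_le_coe.2 le_top)).comp z contDiffAt_fst
  have hflip1 : ContDiffAt ℝ 1 (fun z : E × E ↦ (fderiv ℝ G z.1).flip) z :=
    (ContinuousLinearMap.flipₗᵢ ℝ E E (E →L[ℝ] ℝ)).contDiff.contDiffAt.comp z h1
  have hflip2 : ContDiffAt ℝ 1 (fun z : E × E ↦ ((fderiv ℝ G z.1).flip z.2).flip) z :=
    (ContinuousLinearMap.flipₗᵢ ℝ E E ℝ).contDiff.contDiffAt.comp z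
      (hflip1.clm_apply contDiffAt_snd)
  have hforce : ContDiffAt ℝ 1 (force G) z :=
    (hflip2.clm_apply contDiffAt_snd).sub
      (((h1.clm_apply contDiffAt_snd).clm_apply contDiffAt_snd).const_smul (2 : ℝ))
  have hinv : ContDiffAt ℝ 1 (fun z : E × E ↦ (G z.1).inverse) z :=
    (h.isInvertible_metric hz).contDiffAt_map_inverse.comp z
      ((hG.of_le (by exact_mod_cast le_top)).comp z contDiffAt_fst)
  exact (hinv.clm_apply hforce).const_smul _

theorem contDiffAt_directionField [FiniteDimensional ℝ E] (h : LorentzPatch Ω G U)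
    (τ : E →L[ℝ] ℝ) {z : E × E} (hz : z.1 ∈ Ω) : ContDiffAt ℝ 1 (directionField G τ) z :=
  contDiffAt_snd.prodMk ((h.contDiffAt_accel hz).sub
    ((τ.contDiff.contDiffAt.comp z (h.contDiffAt_accel hz)).smul contDiffAt_snd))

/-- The geodesic equation, solved for the acceleration. -/
theorem exists_deriv_deriv_eq [FiniteDimensional ℝ E] (h : LorentzPatch Ω G U) {u v w : E}
    (hu : u ∈ Ω) (hv : G u U v < 0)
    (hEL : ∀ x, G u v x = 0 → fderiv ℝ G u x v v - 2 * fderiv ℝ G u v v x - 2 * G u w x = 0) :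
    ∃ l : ℝ, w = accel G (u, v) + l • v := by
  have hvU : G u v U ≠ 0 := by rw [h.symm u hu]; exact hv.ne
  set Q : E →L[ℝ] ℝ := force G (u, v) - (2 : ℝ) • G u w with hQ
  have hQ0 : ∀ x, G u v x = 0 → Q x = 0 := fun x hx ↦ by
    simpa [hQ, force] using hEL x hx
  -- `Q` vanishes on the kernel of `G u v`, hence is a multiple of it; the factor is read off at
  -- `U`, where `G u v U ≠ 0`.
  set l := Q U / G u v U with hl
  have hQl : Q = l • G u v := by
    ext x
    have h1 := hQ0 (x - (G u v x / G u v U) • U) (by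
      simp only [map_sub, map_smul, smul_eq_mul]
      field_simp
      ring)
    simp only [map_sub, map_smul, smul_eq_mul] at h1
    simp only [smul_apply, smul_eq_mul, hl]
    linear_combination h1
  have hinv := h.isInvertible_metric hu
  refine ⟨-(l / 2), ?_⟩
  have : (G u) (w + (l / 2) • v) = (1 / 2 : ℝ) • force G (u, v) := by
    have hf : force G (u, v) = l • G u v + (2 : ℝ) • G u w := by rw [← hQl, hQ]; abel
    rw [hf, map_add, map_smul]
    module
  rw [accel, ← map_smul, ← this, hinv.inverse_apply_self]
  module

/-- The geodesic equation leaves an unknown multiple of the velocity `c'` in the acceleration. It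
drops out of the derivative of `c' / τ(c')`, so the pair of `c` and this normalized velocity follows
`directionField`, with `τ(c) - τ(c a)` as parameter. -/
theorem CausalOn.exists_eq_integralCurve [FiniteDimensional ℝ E] (h : LorentzPatch Ω G U)
    {c : ℝ → E} {a b : ℝ} (hab : a < b) (hc : CausalOn Ω G U c a b)
    (hno : ∀ t₁ ∈ Icc a b, ∀ t₂ ∈ Icc a b, t₁ < t₂ → ¬ ∀ᶠ x in 𝓝 (c t₁), Link Ω G U x (c t₂))
    (τ : E →L[ℝ] ℝ) (hτ : 0 < τ (derivWithin c (Icc a b) a)) {W : ℝ → E × E} {ε : ℝ}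
    (hε : 0 < ε) (hW : ∀ t ∈ Ioo (-ε) ε, HasDerivAt W (directionField G τ (W t)) t)
    (hW0 : W 0 = (c a, (τ (derivWithin c (Icc a b) a))⁻¹ • derivWithin c (Icc a b) a)) :
    ∃ e ∈ Ioc a b, StrictMonoOn (fun t ↦ τ (c t) - τ (c a)) (Icc a e) ∧
      ∀ t ∈ Icc a e, 0 < τ (derivWithin c (Icc a b) t) ∧
        (c t, (τ (derivWithin c (Icc a b) t))⁻¹ • derivWithin c (Icc a b) t) =
          W (τ (c t) - τ (c a)) := by
  set c' := derivWithin c (Icc a b) with hc'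
  have haI : a ∈ Icc a b := left_mem_Icc.2 hab.le
  have hc'c : ContinuousOn c' (Icc a b) := continuousOn_derivWithin_Icc hab hc.1
  have hrc : ContinuousOn (fun t ↦ τ (c' t)) (Icc a b) := τ.continuous.comp_continuousOn hc'c
  have hev : ∀ᶠ t in 𝓝[≥] a, t ∈ Icc a b ∧ 0 < τ (c' t) := by
    rw [← nhdsWithin_Icc_eq_nhdsGE hab]
    filter_upwards [self_mem_nhdsWithin, (hrc a haI).eventually_const_lt hτ] with t h1 h2
      using ⟨h1, h2⟩
  obtain ⟨e₁, hae₁, he₁⟩ := mem_nhdsGE_iff_exists_Icc_subset.1 hev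
  have hae₁ : a < e₁ := hae₁
  have hsub : Icc a e₁ ⊆ Icc a b := fun t ht ↦ (he₁ ht).1
  have hsubo : Ioo a e₁ ⊆ Ioo a b := Ioo_subset_Ioo_right (hsub (right_mem_Icc.2 hae₁.le)).2
  have hdc : ∀ t ∈ Ioo a b, HasDerivAt c (c' t) t := fun t ht ↦
    (hc.1.differentiableOn (by simp) t (Ioo_subset_Icc_self ht)).hasDerivWithinAt.hasDerivAt
      (Icc_mem_nhds ht.1 ht.2)
  have hc'eq : ∀ t ∈ Ioo a b, c' =ᶠ[𝓝 t] deriv c := fun t ht ↦ by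
    filter_upwards [Ioo_mem_nhds ht.1 ht.2] with s hs using (hdc s hs).deriv.symm
  have hdd : ∀ t ∈ Ioo a b, ∃ l : ℝ, HasDerivAt c' (accel G (c t, c' t) + l • c' t) t := by
    intro t ht
    obtain ⟨hΩ, -, hU⟩ := hc.2 t (Ioo_subset_Icc_self ht)
    have hcd : ContDiffAt ℝ ∞ c t := hc.1.contDiffAt (Icc_mem_nhds ht.1 ht.2)
    have hd2 : HasDerivAt (deriv c) (deriv (deriv c) t) t :=
      ((hcd.derivWithin (m := ∞) (by simp)).differentiableAt (by simp)).hasDerivAt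
    obtain ⟨l, hl⟩ := h.exists_deriv_deriv_eq (w := deriv (deriv c) t) hΩ hU fun x hx ↦ by
      rw [← hc', (hc'eq t ht).eq_of_nhds] at hx ⊢
      exact h.eulerLagrange_eq_zero hc hno ht hx
    exact ⟨l, (hl ▸ hd2).congr_of_eventuallyEq (hc'eq t ht)⟩
  set y : ℝ → E × E := fun t ↦ (c t, (τ (c' t))⁻¹ • c' t) with hy
  have hyc : ContinuousOn y (Icc a e₁) := (hc.1.continuousOn.mono hsub).prodMk
    (((hrc.mono hsub).inv₀ fun t ht ↦ (he₁ ht).2.ne').smul (hc'c.mono hsub))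
  have hyd : ∀ t ∈ Ioo a e₁, HasDerivAt y (τ (c' t) • directionField G τ (y t)) t := by
    intro t ht
    have hr : τ (c' t) ≠ 0 := (he₁ (Ioo_subset_Icc_self ht)).2.ne'
    obtain ⟨l, hl⟩ := hdd t (hsubo ht)
    have hτd : HasDerivAt (fun t ↦ τ (c' t)) (τ (accel G (c t, c' t) + l • c' t)) t :=
      τ.hasFDerivAt.comp_hasDerivAt t hl
    refine ((hdc t (hsubo ht)).prodMk ((hτd.inv hr).smul hl)).congr_deriv ?_
    have hacc : accel G (c t, c' t) = (τ (c' t)) ^ 2 • accel G (y t) := by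
      rw [hy, ← accel_smul, smul_smul, mul_inv_cancel₀ hr, one_smul]
    simp only [directionField, Prod.smul_mk, hacc]
    refine Prod.ext ?_ ?_
    · simp [hy, smul_smul, hr]
    · simp only [hy, Pi.inv_apply, map_add, map_smul, smul_eq_mul]
      match_scalars <;> field_simp
      ring
  obtain ⟨e₂, he₂, heq⟩ := eventually_eq_integralCurve_comp (y := y) (W := W)
    (θ := fun t ↦ τ (c t) - τ (c a)) (r := fun t ↦ τ (c' t)) hae₁ hε
    (h.contDiffAt_directionField τ (hc.2 a haI).1) hW0 hW hyc
    ((τ.continuous.comp_continuousOn (hc.1.continuousOn.mono hsub)).sub continuousOn_const)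
    (hrc.mono hsub) (by simp) hyd
    (fun t ht ↦ (τ.hasFDerivAt.comp_hasDerivAt t (hdc t (hsubo ht))).sub_const _)
  have hsub₂ : Icc a e₂ ⊆ Icc a e₁ := Icc_subset_Icc_right he₂.2
  refine ⟨e₂, ⟨he₂.1, (hsub (hsub₂ (right_mem_Icc.2 he₂.1.le))).2⟩, ?_, fun t ht ↦
    ⟨(he₁ (hsub₂ ht)).2, heq t ht⟩⟩
  refine strictMonoOn_of_deriv_pos (convex_Icc _ _) ((τ.continuous.comp_continuousOn
    (hc.1.continuousOn.mono (hsub₂.trans hsub))).sub continuousOn_const) fun t ht ↦ ?_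
  rw [interior_Icc] at ht
  have ht₁ : t ∈ Ioo a e₁ := Ioo_subset_Ioo_right he₂.2 ht
  have hd : HasDerivAt (fun t ↦ τ (c t) - τ (c a)) (τ (c' t)) t :=
    (τ.hasFDerivAt.comp_hasDerivAt t (hdc t (hsubo ht₁))).sub_const _
  rw [hd.deriv]
  exact (he₁ (Ioo_subset_Icc_self ht₁)).2

/-- Two causal curves that cannot be deformed to timelike ones agree for some time, up to
parametrization, if they start at the same point in the same direction. -/
theorem exists_eq_and_sameRay [FiniteDimensional ℝ E] (h : LorentzPatch Ω G U)
    {c d : ℝ → E} {a b a' b' : ℝ} (hab : a < b) (hab' : a' < b')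
    (hc : CausalOn Ω G U c a b) (hd : CausalOn Ω G U d a' b')
    (hnoc : ∀ t₁ ∈ Icc a b, ∀ t₂ ∈ Icc a b, t₁ < t₂ → ¬ ∀ᶠ x in 𝓝 (c t₁), Link Ω G U x (c t₂))
    (hnod : ∀ t₁ ∈ Icc a' b', ∀ t₂ ∈ Icc a' b', t₁ < t₂ →
      ¬ ∀ᶠ x in 𝓝 (d t₁), Link Ω G U x (d t₂))
    (hcd : c a = d a')
    (hray : SameRay ℝ (derivWithin c (Icc a b) a) (derivWithin d (Icc a' b') a')) :
    ∀ᶠ t in 𝓝[>] a, ∃ s ∈ Ioc a' b', c t = d s ∧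
      SameRay ℝ (derivWithin c (Icc a b) t) (derivWithin d (Icc a' b') s) := by
  have : CompleteSpace E := FiniteDimensional.complete ℝ E
  obtain ⟨hΩ, -, hUc⟩ := hc.2 a (left_mem_Icc.2 hab.le)
  obtain ⟨-, -, hUd⟩ := hd.2 a' (left_mem_Icc.2 hab'.le)
  rw [← hcd] at hUd
  -- This form is positive on both initial velocities. The normalized initial data then coincide,
  -- and a single integral curve `W` serves `c` and `d`.
  set τ : E →L[ℝ] ℝ := -(G (c a) U) with hτ
  set v := derivWithin c (Icc a b) a with hv
  set w := derivWithin d (Icc a' b') a' with hw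
  have hτv : 0 < τ v := by simpa [hτ] using hUc
  have hτw : 0 < τ w := by simpa [hτ] using hUd
  have hvw : (τ v)⁻¹ • v = (τ w)⁻¹ • w := by
    have hv0 : v ≠ 0 := fun h0 ↦ by simp [h0] at hτv
    have hw0 : w ≠ 0 := fun h0 ↦ by simp [h0] at hτw
    obtain ⟨r, hr, hrw⟩ := hray.exists_pos_left hv0 hw0
    rw [← hrw, map_smul, smul_eq_mul, smul_smul]
    congr 1
    field_simp
  obtain ⟨W, hW0, ε, hε, hW⟩ :=
    (h.contDiffAt_directionField τ (z := (c a, (τ v)⁻¹ • v))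
      hΩ).exists_forall_mem_closedBall_exists_eq_forall_mem_Ioo_hasDerivAt₀ 0
  simp only [zero_sub, zero_add] at hW
  obtain ⟨e, he, hmono, heq⟩ := hc.exists_eq_integralCurve h hab hnoc τ hτv hε hW hW0
  obtain ⟨e', he', hmono', heq'⟩ := hd.exists_eq_integralCurve h hab' hnod τ hτw hε hW
    (by rw [hW0, hcd, hvw])
  have hpos : ∀ t ∈ Ioc a e, 0 < τ (c t) - τ (c a) := fun t ht ↦ by
    simpa using hmono (left_mem_Icc.2 he.1.le) (Ioc_subset_Icc_self ht) ht.1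
  have hpos' : 0 < τ (d e') - τ (d a') := by
    simpa using hmono' (left_mem_Icc.2 he'.1.le) (right_mem_Icc.2 he'.1.le) he'.1
  have hlim : Tendsto (fun t ↦ τ (c t) - τ (c a)) (𝓝[>] a) (𝓝 0) := by
    have h1 : ContinuousWithinAt (fun t ↦ τ (c t) - τ (c a)) (Icc a b) a :=
      ((τ.continuous.comp_continuousOn hc.1.continuousOn).sub continuousOn_const) a
        (left_mem_Icc.2 hab.le)
    have h2 := h1.mono Ioo_subset_Icc_self
    rw [ContinuousWithinAt, nhdsWithin_Ioo_eq_nhdsGT hab] at h2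
    simpa using h2
  filter_upwards [Ioc_mem_nhdsGT he.1, hlim.eventually_lt_const hpos'] with t ht hlt
  have hcont : ContinuousOn (fun s ↦ τ (d s) - τ (d a')) (Icc a' e') :=
    (τ.continuous.comp_continuousOn (hd.1.continuousOn.mono
      (Icc_subset_Icc_right he'.2))).sub continuousOn_const
  -- The parameter `s` at which `d` has reached the same value of `τ` as `c` at `t`.
  obtain ⟨s, hs, hst⟩ := intermediate_value_Icc he'.1.le hcont
    (show τ (c t) - τ (c a) ∈ _ from ⟨by simpa using (hpos t ht).le, hlt.le⟩)
  have hsa : a' < s := by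
    refine hs.1.lt_of_ne ?_
    rintro rfl
    have := hpos t ht
    simp only [sub_self] at hst
    linarith
  obtain ⟨h1, h2⟩ := heq t (Ioc_subset_Icc_self ht)
  obtain ⟨h1', h2'⟩ := heq' s hs
  rw [← hst, ← h2'] at h2
  refine ⟨s, ⟨hsa, hs.2.trans he'.2⟩, congrArg Prod.fst h2, ?_⟩
  have h3 := congrArg Prod.snd h2
  exact Or.inr (Or.inr ⟨_, _, inv_pos.2 h1, inv_pos.2 h1', h3⟩)

end LorentzPatch

end Patch

namespace Spacetime

variable {n : ℕ} {M : Type*} [TopologicalSpace M]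
  [ChartedSpace (EuclideanSpace ℝ (Fin (n + 1))) M] [IsManifold (𝓡 (n + 1)) ∞ M]

/-! ### Lorentzian linear algebra in a tangent space -/

section LinearAlgebra

variable (S : Spacetime n M) {x : M}

/-- Subtracting `l • t` from `d` removes the time component in a Lorentz basis, whence `0 ≤ g(d,d) +
l² g(t,t)`. If `g(d,d) ≤ 0`, both terms vanish, so `l = 0` and `d = 0`. -/
theorem pos_of_orthogonal_timelike {t d : TangentSpace (𝓡 (n + 1)) x} (ht : S.g x t t < 0)
    (htd : S.g x t d = 0) (hd : d ≠ 0) : 0 < S.g x d d := by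
  obtain ⟨b, hb⟩ := S.lorentzian x
  have hexp : ∀ v, S.g x v v = ∑ i, (if i = 0 then -1 else 1) * (b.repr v i) ^ 2 := by
    intro v
    conv_lhs => rw [← b.sum_repr v]
    simp only [map_sum, map_smul, sum_apply, smul_apply, smul_eq_mul, hb]
    refine Finset.sum_congr rfl fun i _ ↦ ?_
    rw [Finset.sum_eq_single i]
    · simp only [if_true]; ring
    · intro j _ hj
      simp [hj]
    · simp
  have hspace : ∀ v, b.repr v 0 = 0 → 0 ≤ S.g x v v ∧ (S.g x v v = 0 → v = 0) := by
    intro v hv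
    have hterm : ∀ i, (if i = 0 then -1 else 1) * (b.repr v i) ^ 2 = (b.repr v i) ^ 2 := by
      intro i
      split_ifs with hi
      · simp [hi, hv]
      · simp
    have hv2 : S.g x v v = ∑ i, (b.repr v i) ^ 2 := by
      rw [hexp]; exact Finset.sum_congr rfl fun i _ ↦ hterm i
    refine ⟨hv2 ▸ Finset.sum_nonneg fun i _ ↦ sq_nonneg _, fun h0 ↦ ?_⟩
    rw [hv2, Finset.sum_eq_zero_iff_of_nonneg fun i _ ↦ sq_nonneg _] at h0
    refine b.ext_elem fun i ↦ ?_
    simpa using h0 i (Finset.mem_univ i)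
  have ht0 : b.repr t 0 ≠ 0 := fun h0 ↦ (hspace t h0).1.not_gt ht
  by_contra hcon
  set l := b.repr d 0 / b.repr t 0 with hl
  obtain ⟨h1, h2⟩ := hspace (d - l • t) (by simp [hl, div_mul_cancel₀ _ ht0])
  have hval : S.g x (d - l • t) (d - l • t) = S.g x d d + l ^ 2 * S.g x t t := by
    simp only [map_sub, map_smul, sub_apply, smul_apply, smul_eq_mul, htd, S.symm x d t]
    ring
  have hneg : l ^ 2 * S.g x t t ≤ 0 := mul_nonpos_of_nonneg_of_nonpos (sq_nonneg _) ht.le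
  have hzero : l ^ 2 * S.g x t t = 0 := by linarith [not_lt.1 hcon]
  have hl0 : l = 0 := by simpa [ht.ne] using hzero
  have := h2 (by linarith [not_lt.1 hcon])
  rw [hl0, zero_smul, sub_zero] at this
  exact hd this

/-- Two timelike vectors in the same cone induce the same notion of future on causal vectors. This
allows the time orientation to be replaced by a constant vector in a chart. As `v - l • t'` is
orthogonal to `t`, its square is positive unless it is zero. -/
theorem neg_of_neg_of_timelike {t t' v : TangentSpace (𝓡 (n + 1)) x} (ht : S.g x t t < 0)
    (ht' : S.g x t' t' < 0) (htt' : S.g x t t' < 0) (hv : S.g x v v ≤ 0) (htv : S.g x t v < 0) :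
    S.g x t' v < 0 := by
  have hl : 0 < S.g x t v / S.g x t t' := div_pos_of_neg_of_neg htv htt'
  set l := S.g x t v / S.g x t t' with hldef
  have hd0 : S.g x t (v - l • t') = 0 := by
    simp only [map_sub, map_smul, smul_eq_mul, hldef]
    field_simp [htt'.ne]
    ring
  by_cases hd : v - l • t' = 0
  · rw [sub_eq_zero.1 hd, map_smul, smul_eq_mul]
    exact mul_neg_of_pos_of_neg hl ht'
  have hp := S.pos_of_orthogonal_timelike ht hd0 hd
  simp only [map_sub, map_smul, smul_eq_mul, sub_apply, smul_apply, S.symm x v t'] at hp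
  by_contra hcon
  nlinarith [mul_nonneg hl.le (not_lt.1 hcon),
    mul_nonneg (mul_nonneg hl.le hl.le) (neg_nonneg.2 ht'.le)]

end LinearAlgebra

/-! ### The metric and time orientation in a chart -/

section Chart

/-- The coordinates of tangent vectors at `x` in the chart at `x₀`. -/
noncomputable def toCoord (x₀ x : M) :
    TangentSpace (𝓡 (n + 1)) x →L[ℝ] EuclideanSpace ℝ (Fin (n + 1)) :=
  (trivializationAt (EuclideanSpace ℝ (Fin (n + 1))) (TangentSpace (𝓡 (n + 1)))
    x₀).continuousLinearMapAt ℝ x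

/-- The tangent vector at `x` with given coordinates in the chart at `x₀`. -/
noncomputable def ofCoord (x₀ x : M) :
    EuclideanSpace ℝ (Fin (n + 1)) →L[ℝ] TangentSpace (𝓡 (n + 1)) x :=
  (trivializationAt (EuclideanSpace ℝ (Fin (n + 1))) (TangentSpace (𝓡 (n + 1))) x₀).symmL ℝ x

/-- The metric in the coordinates of the chart at `x₀`. -/
noncomputable def chartMetric (S : Spacetime n M) (x₀ : M) (u : EuclideanSpace ℝ (Fin (n + 1))) :
    EuclideanSpace ℝ (Fin (n + 1)) →L[ℝ] EuclideanSpace ℝ (Fin (n + 1)) →L[ℝ] ℝ :=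
  (ContinuousLinearMap.precomp ℝ (ofCoord x₀ ((extChartAt (𝓡 (n + 1)) x₀).symm u))).comp
    ((S.g ((extChartAt (𝓡 (n + 1)) x₀).symm u)).comp
      (ofCoord x₀ ((extChartAt (𝓡 (n + 1)) x₀).symm u)))

/-- The coordinates of the time orientation at `x₀`. -/
noncomputable def chartTime (S : Spacetime n M) (x₀ : M) : EuclideanSpace ℝ (Fin (n + 1)) :=
  toCoord x₀ x₀ (S.T x₀)

/-- The coordinate domain around `x₀` in which the vector with the coordinates of the time
orientation at `x₀` is timelike and future directed. -/
def chartDomain (S : Spacetime n M) (x₀ : M) : Set (EuclideanSpace ℝ (Fin (n + 1))) :=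
  {u | u ∈ (extChartAt (𝓡 (n + 1)) x₀).target ∧
    S.chartMetric x₀ u (S.chartTime x₀) (S.chartTime x₀) < 0 ∧
    S.chartMetric x₀ u (S.chartTime x₀) (toCoord x₀ ((extChartAt (𝓡 (n + 1)) x₀).symm u)
      (S.T ((extChartAt (𝓡 (n + 1)) x₀).symm u))) < 0}

variable (S : Spacetime n M) {x₀ x : M}

theorem mem_baseSet (hx : x ∈ (extChartAt (𝓡 (n + 1)) x₀).source) :
    x ∈ (trivializationAt (EuclideanSpace ℝ (Fin (n + 1))) (TangentSpace (𝓡 (n + 1)))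
      x₀).baseSet := by
  rwa [TangentBundle.trivializationAt_baseSet, ← extChartAt_source (𝓡 (n + 1))]

theorem ofCoord_toCoord (hx : x ∈ (extChartAt (𝓡 (n + 1)) x₀).source)
    (v : TangentSpace (𝓡 (n + 1)) x) : ofCoord x₀ x (toCoord x₀ x v) = v :=
  Bundle.Trivialization.symmL_continuousLinearMapAt _ (mem_baseSet hx) v

theorem toCoord_ofCoord (hx : x ∈ (extChartAt (𝓡 (n + 1)) x₀).source)
    (v : EuclideanSpace ℝ (Fin (n + 1))) : toCoord x₀ x (ofCoord x₀ x v) = v :=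
  Bundle.Trivialization.continuousLinearMapAt_symmL _ (mem_baseSet hx) v

theorem toCoord_injective (hx : x ∈ (extChartAt (𝓡 (n + 1)) x₀).source) :
    Function.Injective (toCoord (n := n) x₀ x) :=
  Function.LeftInverse.injective (ofCoord_toCoord hx)

theorem chartMetric_apply (u v w : EuclideanSpace ℝ (Fin (n + 1))) :
    S.chartMetric x₀ u v w = S.g ((extChartAt (𝓡 (n + 1)) x₀).symm u)
      (ofCoord x₀ ((extChartAt (𝓡 (n + 1)) x₀).symm u) v)
      (ofCoord x₀ ((extChartAt (𝓡 (n + 1)) x₀).symm u) w) := rfl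

theorem chartMetric_extChartAt (hx : x ∈ (extChartAt (𝓡 (n + 1)) x₀).source)
    (v w : EuclideanSpace ℝ (Fin (n + 1))) :
    S.chartMetric x₀ (extChartAt (𝓡 (n + 1)) x₀ x) v w =
      S.g x (ofCoord x₀ x v) (ofCoord x₀ x w) := by
  rw [chartMetric_apply, (extChartAt (𝓡 (n + 1)) x₀).left_inv hx]

/-- In the trivialization at `x₀` this section is constant. -/
theorem contMDiffOn_ofCoord (v : EuclideanSpace ℝ (Fin (n + 1))) :
    ContMDiffOn (𝓡 (n + 1)) ((𝓡 (n + 1)).prod 𝓘(ℝ, EuclideanSpace ℝ (Fin (n + 1)))) ∞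
      (fun x : M ↦ (⟨x, ofCoord x₀ x v⟩ : TangentBundle (𝓡 (n + 1)) M))
      (extChartAt (𝓡 (n + 1)) x₀).source := by
  have := (Bundle.Trivialization.contMDiffOn_section_baseSet_iff (IB := 𝓡 (n + 1)) (n := ∞)
    (s := fun x : M ↦ ofCoord x₀ x v)
    (trivializationAt (EuclideanSpace ℝ (Fin (n + 1))) (TangentSpace (𝓡 (n + 1))) x₀)).2
    ((contMDiffOn_const (c := v)).congr fun y hy ↦ by
      rw [ofCoord, Bundle.Trivialization.symmL_apply _ hy]
      exact congrArg Prod.snd (Bundle.Trivialization.apply_mk_symm _ hy v))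
  rwa [TangentBundle.trivializationAt_baseSet, ← extChartAt_source (𝓡 (n + 1))] at this

theorem contDiffOn_chartMetric :
    ContDiffOn ℝ ∞ (S.chartMetric x₀) (extChartAt (𝓡 (n + 1)) x₀).target := by
  refine contDiffOn_clm_apply.2 fun v ↦ contDiffOn_clm_apply.2 fun w ↦ ?_
  rw [← contMDiffOn_iff_contDiffOn]
  have hsm : ContMDiffOn (𝓡 (n + 1)) 𝓘(ℝ, ℝ) ∞
      (fun x : M ↦ S.g x (ofCoord x₀ x v) (ofCoord x₀ x w))
      (extChartAt (𝓡 (n + 1)) x₀).source := by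
    intro x hx
    have : ContMDiffWithinAt (𝓡 (n + 1)) ((𝓡 (n + 1)).prod 𝓘(ℝ, ℝ)) ∞
        (fun x : M ↦ Bundle.TotalSpace.mk' ℝ (E := Bundle.Trivial M ℝ) x
          (S.g x (ofCoord x₀ x v) (ofCoord x₀ x w))) (extChartAt (𝓡 (n + 1)) x₀).source x := by
      apply ContMDiffWithinAt.clm_bundle_apply₂ (F₁ := EuclideanSpace ℝ (Fin (n + 1)))
        (F₂ := EuclideanSpace ℝ (Fin (n + 1)))
      · exact S.smooth.contMDiffAt.contMDiffWithinAt
      · exact contMDiffOn_ofCoord v x hx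
      · exact contMDiffOn_ofCoord w x hx
    simp only [Bundle.contMDiffWithinAt_totalSpace] at this
    exact this.2
  exact hsm.comp (contMDiffOn_extChartAt_symm x₀) fun u hu ↦
    (extChartAt (𝓡 (n + 1)) x₀).map_target hu

theorem continuousOn_toCoord_time :
    ContinuousOn (fun x : M ↦ toCoord x₀ x (S.T x)) (extChartAt (𝓡 (n + 1)) x₀).source := by
  set e := trivializationAt (EuclideanSpace ℝ (Fin (n + 1))) (TangentSpace (𝓡 (n + 1))) x₀
  have h1 : ContinuousOn (fun x : M ↦ (e ⟨x, S.T x⟩).2) (extChartAt (𝓡 (n + 1)) x₀).source :=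
    continuous_snd.comp_continuousOn (e.continuousOn.comp S.continuous_T.continuousOn
      fun x hx ↦ e.mem_source.2 (mem_baseSet hx))
  refine h1.congr fun x hx ↦ ?_
  exact Bundle.Trivialization.continuousLinearMapAt_apply_of_mem ℝ e (mem_baseSet hx) _

theorem chartDomain_subset : S.chartDomain x₀ ⊆ (extChartAt (𝓡 (n + 1)) x₀).target :=
  fun _ hu ↦ hu.1

theorem isOpen_chartDomain : IsOpen (S.chartDomain x₀) := by
  have htgt := isOpen_extChartAt_target (I := 𝓡 (n + 1)) x₀
  have hG := (S.contDiffOn_chartMetric (x₀ := x₀)).continuousOn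
  have hT : ContinuousOn (fun u ↦ toCoord x₀ ((extChartAt (𝓡 (n + 1)) x₀).symm u)
      (S.T ((extChartAt (𝓡 (n + 1)) x₀).symm u))) (extChartAt (𝓡 (n + 1)) x₀).target :=
    S.continuousOn_toCoord_time.comp (continuousOn_extChartAt_symm x₀)
      fun u hu ↦ (extChartAt (𝓡 (n + 1)) x₀).map_target hu
  refine isOpen_iff_mem_nhds.2 fun u hu ↦ ?_
  have hn := htgt.mem_nhds hu.1
  filter_upwards [hn, ((hG.clm_apply continuousOn_const).clm_apply
    continuousOn_const).continuousAt hn |>.eventually_lt_const hu.2.1,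
    ((hG.clm_apply continuousOn_const).clm_apply hT).continuousAt hn
      |>.eventually_lt_const hu.2.2] with y h1 h2 h3 using ⟨h1, h2, h3⟩

theorem mem_chartDomain_self : extChartAt (𝓡 (n + 1)) x₀ x₀ ∈ S.chartDomain x₀ := by
  have hx := mem_extChartAt_source (I := 𝓡 (n + 1)) x₀
  refine ⟨mem_extChartAt_target x₀, ?_, ?_⟩
  · rw [S.chartMetric_extChartAt hx, chartTime, ofCoord_toCoord hx]
    exact S.timelike_T x₀
  · rw [S.chartMetric_extChartAt hx, chartTime, ofCoord_toCoord hx,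
      (extChartAt (𝓡 (n + 1)) x₀).left_inv hx, ofCoord_toCoord hx]
    exact S.timelike_T x₀

theorem lorentzPatch (x₀ : M) :
    LorentzPatch (S.chartDomain x₀) (S.chartMetric x₀) (S.chartTime x₀) where
  isOpen := S.isOpen_chartDomain
  smooth := S.contDiffOn_chartMetric.mono S.chartDomain_subset
  symm u _ v w := S.symm _ _ _
  timelike u hu := hu.2.1
  pos u hu d h0 hd := by
    refine S.pos_of_orthogonal_timelike (t := ofCoord x₀ _ (S.chartTime x₀))
      (d := ofCoord x₀ _ d) hu.2.1 h0 fun h1 ↦ hd ?_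
    rw [← toCoord_ofCoord ((extChartAt (𝓡 (n + 1)) x₀).map_target hu.1) d, h1, map_zero]

/-- The two conditions on the chart domain put the constant vector `chartTime` in the same cone as
the time orientation. A vector with negative product with it is automatically nonzero. -/
theorem causal_futureDirected_iff (hx : x ∈ (extChartAt (𝓡 (n + 1)) x₀).source)
    (hΩ : extChartAt (𝓡 (n + 1)) x₀ x ∈ S.chartDomain x₀) (v : TangentSpace (𝓡 (n + 1)) x) :
    (S.IsCausal v ∧ S.IsFutureDirected v) ↔
      S.chartMetric x₀ (extChartAt (𝓡 (n + 1)) x₀ x) (toCoord x₀ x v) (toCoord x₀ x v) ≤ 0 ∧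
      S.chartMetric x₀ (extChartAt (𝓡 (n + 1)) x₀ x) (S.chartTime x₀) (toCoord x₀ x v) < 0 := by
  obtain ⟨-, h1, h2⟩ := hΩ
  rw [(extChartAt (𝓡 (n + 1)) x₀).left_inv hx] at h2
  simp only [S.chartMetric_extChartAt hx, ofCoord_toCoord hx] at h1 h2 ⊢
  constructor
  · rintro ⟨⟨-, hv⟩, hf⟩
    exact ⟨hv, S.neg_of_neg_of_timelike (S.timelike_T x) h1 (by rwa [S.symm]) hv hf⟩
  · rintro ⟨hv, hf⟩
    refine ⟨⟨?_, hv⟩, S.neg_of_neg_of_timelike h1 (S.timelike_T x) h2 hv hf⟩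
    rintro rfl
    simp at hf

end Chart

/-! ### Causal curves on the manifold and in a chart -/

section Velocity

/-- The velocity of a curve on `[a, b]`, one-sided at the end points. -/
noncomputable def velocity (γ : ℝ → M) (a b s : ℝ) : EuclideanSpace ℝ (Fin (n + 1)) :=
  mfderivWithin 𝓘(ℝ, ℝ) (𝓡 (n + 1)) γ (Icc a b) s (1 : ℝ)

/-- The chain rule, combined with the fact that the derivative of the chart is the trivialization of
the tangent bundle. -/
theorem derivWithin_extChartAt_comp {x₀ : M} {γ : ℝ → M} {a b s : ℝ} (hab : a < b)
    (hs : s ∈ Icc a b) (hγ : MDifferentiableWithinAt 𝓘(ℝ, ℝ) (𝓡 (n + 1)) γ (Icc a b) s)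
    (hx : γ s ∈ (extChartAt (𝓡 (n + 1)) x₀).source) :
    derivWithin (extChartAt (𝓡 (n + 1)) x₀ ∘ γ) (Icc a b) s =
      toCoord x₀ (γ s) (velocity γ a b s) := by
  have hx' : γ s ∈ (chartAt (EuclideanSpace ℝ (Fin (n + 1))) x₀).source := by
    rwa [← extChartAt_source (𝓡 (n + 1))]
  have h1 := ((mdifferentiableAt_extChartAt (I := 𝓡 (n + 1)) hx').hasMFDerivAt).comp_hasMFDerivWithinAt
    s hγ.hasMFDerivWithinAt
  rw [hasMFDerivWithinAt_iff_hasFDerivWithinAt] at h1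
  let L : ℝ →L[ℝ] EuclideanSpace ℝ (Fin (n + 1)) :=
    (mfderiv (𝓡 (n + 1)) 𝓘(ℝ, EuclideanSpace ℝ (Fin (n + 1))) (extChartAt (𝓡 (n + 1)) x₀)
      (γ s)).comp (mfderivWithin 𝓘(ℝ, ℝ) (𝓡 (n + 1)) γ (Icc a b) s)
  have h2 : HasFDerivWithinAt (extChartAt (𝓡 (n + 1)) x₀ ∘ γ) L (Icc a b) s := h1
  rw [h2.hasDerivWithinAt.derivWithin (uniqueDiffOn_Icc hab s hs), toCoord,
    TangentBundle.continuousLinearMapAt_trivializationAt hx']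
  rfl

variable {S : Spacetime n M} {x₀ : M}

theorem IsSmoothCausalOn.causalOn {γ : ℝ → M} {a b : ℝ} (hγ : S.IsSmoothCausalOn γ a b)
    (hab : a < b) (hx : ∀ t ∈ Icc a b, γ t ∈ (extChartAt (𝓡 (n + 1)) x₀).source)
    (hΩ : ∀ t ∈ Icc a b, extChartAt (𝓡 (n + 1)) x₀ (γ t) ∈ S.chartDomain x₀) :
    LorentzPatch.CausalOn (S.chartDomain x₀) (S.chartMetric x₀) (S.chartTime x₀)
      (extChartAt (𝓡 (n + 1)) x₀ ∘ γ) a b := by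
  refine ⟨?_, fun t ht ↦ ⟨hΩ t ht, ?_⟩⟩
  · rw [← contMDiffOn_iff_contDiffOn]
    exact contMDiffOn_extChartAt.comp hγ.1 fun t ht ↦ by
      have := hx t ht
      rwa [extChartAt_source] at this
  · rw [derivWithin_extChartAt_comp hab ht (hγ.1.mdifferentiableOn (by simp) t ht) (hx t ht)]
    exact (S.causal_futureDirected_iff (hx t ht) (hΩ t ht) _).1 (hγ.2 t ht)

theorem isSmoothCausalOn_of_causalOn {c : ℝ → EuclideanSpace ℝ (Fin (n + 1))} {a b : ℝ}
    (hab : a < b) (hc : LorentzPatch.CausalOn (S.chartDomain x₀) (S.chartMetric x₀)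
      (S.chartTime x₀) c a b) :
    S.IsSmoothCausalOn ((extChartAt (𝓡 (n + 1)) x₀).symm ∘ c) a b := by
  have htgt : ∀ t ∈ Icc a b, c t ∈ (extChartAt (𝓡 (n + 1)) x₀).target := fun t ht ↦
    S.chartDomain_subset (hc.2 t ht).1
  have hsm : ContMDiffOn 𝓘(ℝ, ℝ) (𝓡 (n + 1)) ∞ ((extChartAt (𝓡 (n + 1)) x₀).symm ∘ c) (Icc a b) :=
    (contMDiffOn_extChartAt_symm x₀).comp (contMDiffOn_iff_contDiffOn.2 hc.1) htgt
  refine ⟨hsm, fun t ht ↦ ?_⟩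
  have hx := (extChartAt (𝓡 (n + 1)) x₀).map_target (htgt t ht)
  have hinv : ∀ t ∈ Icc a b, (extChartAt (𝓡 (n + 1)) x₀ ∘ (extChartAt (𝓡 (n + 1)) x₀).symm ∘ c) t =
      c t := fun t ht ↦ (extChartAt (𝓡 (n + 1)) x₀).right_inv (htgt t ht)
  have hd := derivWithin_extChartAt_comp (x₀ := x₀) hab ht (hsm.mdifferentiableOn (by simp) t ht) hx
  rw [derivWithin_congr hinv (hinv t ht)] at hd
  refine (S.causal_futureDirected_iff (x₀ := x₀) hx ?_ _).2 ?_
  · have := hinv t ht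
    simp only [Function.comp_apply] at this ⊢
    rw [this]
    exact (hc.2 t ht).1
  · have h1 := hinv t ht
    have h2 := (hc.2 t ht).2
    rw [hd] at h2
    simp only [Function.comp_apply] at h1 h2 ⊢
    rw [h1]
    exact h2

end Velocity

end Spacetime

namespace Spacetime

set_option linter.unusedSectionVars false

variable {n : ℕ} {M : Type*} [TopologicalSpace M]
  [ChartedSpace (EuclideanSpace ℝ (Fin (n + 1))) M] [IsManifold (𝓡 (n + 1)) ∞ M]
  {S : Spacetime n M}

/-! ### Causal curves as finite chains of smooth pieces -/

section Pieces

theorem velocity_mono {γ : ℝ → M} {a b a' b' s : ℝ} (hab : a' < b')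
    (hsub : Icc a' b' ⊆ Icc a b) (hs : s ∈ Icc a' b')
    (hγ : MDifferentiableWithinAt 𝓘(ℝ, ℝ) (𝓡 (n + 1)) γ (Icc a b) s) :
    velocity (n := n) γ a' b' s = velocity γ a b s := by
  have h1 := (hγ.hasMFDerivWithinAt.mono hsub).mfderivWithin
    ((uniqueDiffOn_Icc hab).uniqueMDiffOn s hs)
  rw [velocity, velocity, h1]

theorem IsSmoothCausalOn.mono {γ : ℝ → M} {a b a' b' : ℝ} (hγ : S.IsSmoothCausalOn γ a b)
    (ha : a ≤ a') (hb : b' ≤ b) (hab : a' < b') : S.IsSmoothCausalOn γ a' b' := by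
  have hsub : Icc a' b' ⊆ Icc a b := Icc_subset_Icc ha hb
  refine ⟨hγ.1.mono hsub, fun s hs ↦ ?_⟩
  have h1 := ((hγ.1.mdifferentiableOn (by simp) s (hsub hs)).hasMFDerivWithinAt.mono
    hsub).mfderivWithin ((uniqueDiffOn_Icc hab).uniqueMDiffOn s hs)
  rw [h1]
  exact hγ.2 s (hsub hs)

/-- Tangent spaces at equal points are different types, so the two vectors are compared in the model
space. -/
theorem causal_futureDirected_congr {x y : M} (h : x = y) {v : TangentSpace (𝓡 (n + 1)) x}
    {w : TangentSpace (𝓡 (n + 1)) y} (hvw : (show EuclideanSpace ℝ (Fin (n + 1)) from v) = w)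
    (hv : S.IsCausal v ∧ S.IsFutureDirected v) : S.IsCausal w ∧ S.IsFutureDirected w := by
  subst h
  subst hvw
  exact hv

theorem IsSmoothCausalOn.congr {γ γ' : ℝ → M} {a b : ℝ} (hγ : S.IsSmoothCausalOn γ a b)
    (h : ∀ s ∈ Icc a b, γ' s = γ s) : S.IsSmoothCausalOn γ' a b := by
  refine ⟨hγ.1.congr h, fun s hs ↦ causal_futureDirected_congr (h s hs).symm ?_ (hγ.2 s hs)⟩
  have := mfderivWithin_congr (I := 𝓘(ℝ, ℝ)) (I' := 𝓡 (n + 1)) h (h s hs)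
  exact (congrArg (fun L : ℝ →L[ℝ] EuclideanSpace ℝ (Fin (n + 1)) ↦ L 1) this).symm

theorem IsSmoothCausalOn.comp_add {γ : ℝ → M} {a b : ℝ} (hγ : S.IsSmoothCausalOn γ a b)
    (hab : a < b) (e : ℝ) : S.IsSmoothCausalOn (fun s ↦ γ (s + e)) (a - e) (b - e) := by
  have hmaps : MapsTo (fun s ↦ s + e) (Icc (a - e) (b - e)) (Icc a b) := fun s hs ↦
    ⟨by linarith [hs.1], by linarith [hs.2]⟩
  have hsm : ContMDiffOn 𝓘(ℝ, ℝ) 𝓘(ℝ, ℝ) ∞ (fun s : ℝ ↦ s + e) (Icc (a - e) (b - e)) :=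
    contMDiffOn_iff_contDiffOn.2 (contDiff_id.add contDiff_const).contDiffOn
  refine ⟨hγ.1.comp hsm hmaps, fun s hs ↦ ?_⟩
  have hd : HasMFDerivWithinAt 𝓘(ℝ, ℝ) 𝓘(ℝ, ℝ) (fun s : ℝ ↦ s + e) (Icc (a - e) (b - e)) s
      (ContinuousLinearMap.id ℝ ℝ) :=
    hasMFDerivWithinAt_iff_hasFDerivWithinAt.2 ((hasFDerivWithinAt_id s _).add_const e)
  have h1 := (HasMFDerivWithinAt.comp s
    (hγ.1.mdifferentiableOn (by simp) _ (hmaps hs)).hasMFDerivWithinAt hd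
    hmaps.subset_preimage).mfderivWithin
    ((uniqueDiffOn_Icc (by linarith)).uniqueMDiffOn s hs)
  refine causal_futureDirected_congr rfl ?_ (hγ.2 _ (hmaps hs))
  exact (congrArg (fun L : ℝ →L[ℝ] EuclideanSpace ℝ (Fin (n + 1)) ↦ L 1) h1).symm

variable (S) in
/-- Two points are joined by a smooth causal curve without breaks. -/
def Piece (x y : M) : Prop :=
  ∃ (γ : ℝ → M) (a b : ℝ), a < b ∧ S.IsSmoothCausalOn γ a b ∧ γ a = x ∧ γ b = y

theorem IsSmoothCausalOn.piece {γ : ℝ → M} {a b s t : ℝ} (hγ : S.IsSmoothCausalOn γ a b)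
    (hs : a ≤ s) (hst : s < t) (ht : t ≤ b) : S.Piece (γ s) (γ t) :=
  ⟨γ, s, t, hst, hγ.mono hs ht hst, rfl, rfl⟩

theorem IsSmoothCausalOn.reflTransGen {γ : ℝ → M} {a b s t : ℝ} (hγ : S.IsSmoothCausalOn γ a b)
    (hs : a ≤ s) (hst : s ≤ t) (ht : t ≤ b) : Relation.ReflTransGen S.Piece (γ s) (γ t) := by
  rcases hst.eq_or_lt with rfl | hlt
  · exact .refl
  · exact .single (hγ.piece hs hlt ht)

theorem after_of_piece {x y : M} (h : S.Piece x y) : S.After x y := by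
  obtain ⟨γ, a, b, hab, hγ, hx, hy⟩ := h
  refine ⟨γ, a, b, ⟨hab, 1, fun i ↦ if i = 0 then a else b, by simp, by simp, fun i hi ↦ ?_⟩, hx, hy⟩
  obtain rfl : i = 0 := by omega
  simpa using ⟨hab, hγ⟩

theorem After.tail {x y z : M} (h : S.After x y) (h' : S.Piece y z) : S.After x z := by
  obtain ⟨γ, a, b, ⟨hab, k, t, ht0, htk, ht⟩, hx, hy⟩ := h
  obtain ⟨σ, c, d, hcd, hσ, hσc, hσd⟩ := h'
  -- Monotonicity of the partition keeps its old subintervals to the left of `b`, where the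
  -- concatenated curve is `γ`.
  have hle : ∀ j, j ≤ k → ∀ i ≤ j, t i ≤ t j := by
    intro j
    induction j with
    | zero => intro _ i hi; simp [Nat.le_zero.1 hi]
    | succ j ih =>
      intro hj i hi
      rcases Nat.le_succ_iff.1 hi with hi | rfl
      · exact (ih (by omega) i hi).trans (ht j (by omega)).1.le
      · exact le_rfl
  have hσ' := hσ.comp_add hcd (c - b)
  rw [sub_sub_cancel] at hσ'
  refine ⟨fun s ↦ if s ≤ b then γ s else σ (s + (c - b)), a, d - (c - b),
    ⟨by linarith, k + 1, fun i ↦ if i ≤ k then t i else d - (c - b), by simp [ht0], by simp,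
      fun i hi ↦ ?_⟩, by simp [hab.le, hx], ?_⟩
  · rcases Nat.lt_succ_iff_lt_or_eq.1 hi with hi | rfl
    · have hi1 : i + 1 ≤ k := hi
      simp only [hi.le, hi1, if_true]
      refine ⟨(ht i hi).1, (ht i hi).2.congr fun s hs ↦ ?_⟩
      rw [if_pos (hs.2.trans (htk ▸ hle k le_rfl _ hi1))]
    · simp only [le_refl, if_true, Nat.not_succ_le_self, if_false, htk]
      refine ⟨by linarith, hσ'.congr fun s hs ↦ ?_⟩
      rcases hs.1.eq_or_lt with rfl | hlt
      · simp [hy, hσc]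
      · rw [if_neg hlt.not_ge]
  · have : ¬ d - (c - b) ≤ b := not_le.2 (by linarith)
    simpa [this] using hσd

/-- This form reduces statements about piecewise smooth curves to induction over smooth pieces. -/
theorem after_iff_transGen {x y : M} : S.After x y ↔ Relation.TransGen S.Piece x y := by
  constructor
  · rintro ⟨γ, a, b, ⟨hab, k, t, ht0, htk, ht⟩, rfl, rfl⟩
    have key : ∀ j ≤ k, Relation.ReflTransGen S.Piece (γ (t 0)) (γ (t j)) := by
      intro j
      induction j with
      | zero => intro _; exact .refl
      | succ j ih =>
        intro hj
        exact (ih (by omega)).tail ⟨γ, _, _, (ht j hj).1, (ht j hj).2, rfl, rfl⟩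
    obtain _ | k := k
    · exact absurd (ht0.symm.trans htk) hab.ne
    · rw [← ht0, ← htk]
      exact Relation.TransGen.tail' (key k (by omega))
        ⟨γ, _, _, (ht k (by omega)).1, (ht k (by omega)).2, rfl, rfl⟩
  · intro h
    induction h with
    | single h => exact after_of_piece h
    | tail _ h ih => exact ih.tail h

theorem After.trans {x y z : M} (h : S.After x y) (h' : S.After y z) : S.After x z := by
  rw [after_iff_transGen] at *
  exact h.trans h'

theorem After.trans_reflTransGen {x y z : M} (h : S.After x y)
    (h' : Relation.ReflTransGen S.Piece y z) : S.After x z := by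
  rw [after_iff_transGen] at *
  exact h.trans_left h'

end Pieces

/-! ### Interiors of causal pasts -/

section InnerPast

variable (S) in
/-- `x` lies in the interior of the causal past of `y`. -/
def Inner (x y : M) : Prop := ∀ᶠ x' in 𝓝 x, S.After x' y

theorem Inner.trans_reflTransGen {x y z : M} (h : S.Inner x y)
    (h' : Relation.ReflTransGen S.Piece y z) : S.Inner x z :=
  h.mono fun _ hx ↦ hx.trans_reflTransGen h'

variable (S) in
/-- The neighbourhood of `x₀` covered by the chart domain. -/
def chartNhd (x₀ : M) : Set M :=
  (extChartAt (𝓡 (n + 1)) x₀).source ∩ extChartAt (𝓡 (n + 1)) x₀ ⁻¹' S.chartDomain x₀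

theorem isOpen_chartNhd (x₀ : M) : IsOpen (S.chartNhd x₀) :=
  (continuousOn_extChartAt x₀).isOpen_inter_preimage (isOpen_extChartAt_source x₀)
    S.isOpen_chartDomain

theorem mem_chartNhd_self (x₀ : M) : x₀ ∈ S.chartNhd x₀ :=
  ⟨mem_extChartAt_source x₀, S.mem_chartDomain_self⟩

theorem piece_of_link {x₀ : M} {u v : EuclideanSpace ℝ (Fin (n + 1))}
    (h : LorentzPatch.Link (S.chartDomain x₀) (S.chartMetric x₀) (S.chartTime x₀) u v) :
    S.Piece ((extChartAt (𝓡 (n + 1)) x₀).symm u) ((extChartAt (𝓡 (n + 1)) x₀).symm v) := by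
  obtain ⟨c, a, b, hab, hc, rfl, rfl⟩ := h
  exact ⟨_, a, b, hab, isSmoothCausalOn_of_causalOn hab hc, rfl, rfl⟩

theorem eventually_of_eventually_extChartAt {x₀ x : M}
    (hx : x ∈ (extChartAt (𝓡 (n + 1)) x₀).source) {P : M → Prop}
    (h : ∀ᶠ u in 𝓝 (extChartAt (𝓡 (n + 1)) x₀ x), P ((extChartAt (𝓡 (n + 1)) x₀).symm u)) :
    ∀ᶠ x' in 𝓝 x, P x' := by
  have hc : ContinuousAt (extChartAt (𝓡 (n + 1)) x₀) x :=
    (continuousOn_extChartAt x₀).continuousAt ((isOpen_extChartAt_source x₀).mem_nhds hx)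
  filter_upwards [hc.eventually h, (isOpen_extChartAt_source x₀).mem_nhds hx] with y hy hys
  rwa [(extChartAt (𝓡 (n + 1)) x₀).left_inv hys] at hy

theorem inner_of_eventually_link {x₀ x y : M} (hx : x ∈ (extChartAt (𝓡 (n + 1)) x₀).source)
    (hy : y ∈ (extChartAt (𝓡 (n + 1)) x₀).source)
    (h : ∀ᶠ u in 𝓝 (extChartAt (𝓡 (n + 1)) x₀ x), LorentzPatch.Link (S.chartDomain x₀)
      (S.chartMetric x₀) (S.chartTime x₀) u (extChartAt (𝓡 (n + 1)) x₀ y)) : S.Inner x y := by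
  refine eventually_of_eventually_extChartAt hx (h.mono fun u hu ↦ ?_)
  have := piece_of_link hu
  rw [(extChartAt (𝓡 (n + 1)) x₀).left_inv hy] at this
  exact after_of_piece this

theorem exists_Icc_right_subset {γ : ℝ → M} {a b : ℝ} (hab : a < b)
    (hγ : ContinuousOn γ (Icc a b)) {O : Set M} (hO : IsOpen O) (ha : γ a ∈ O) :
    ∃ e ∈ Ioc a b, ∀ t ∈ Icc a e, γ t ∈ O := by
  have hev : ∀ᶠ t in 𝓝[≥] a, t ∈ Icc a b ∧ γ t ∈ O := by
    rw [← nhdsWithin_Icc_eq_nhdsGE hab]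
    filter_upwards [self_mem_nhdsWithin, (hγ a (left_mem_Icc.2 hab.le)).eventually_mem
      (hO.mem_nhds ha)] with t h1 h2 using ⟨h1, h2⟩
  obtain ⟨e, hae, he⟩ := mem_nhdsGE_iff_exists_Icc_subset.1 hev
  exact ⟨e, ⟨hae, (he (right_mem_Icc.2 (le_of_lt hae))).1.2⟩, fun t ht ↦ (he ht).2⟩

theorem exists_Icc_left_subset {γ : ℝ → M} {a b : ℝ} (hab : a < b)
    (hγ : ContinuousOn γ (Icc a b)) {O : Set M} (hO : IsOpen O) (hb : γ b ∈ O) :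
    ∃ e ∈ Ico a b, ∀ t ∈ Icc e b, γ t ∈ O := by
  have hev : ∀ᶠ t in 𝓝[≤] b, t ∈ Icc a b ∧ γ t ∈ O := by
    rw [← nhdsWithin_Icc_eq_nhdsLE hab]
    filter_upwards [self_mem_nhdsWithin, (hγ b (right_mem_Icc.2 hab.le)).eventually_mem
      (hO.mem_nhds hb)] with t h1 h2 using ⟨h1, h2⟩
  obtain ⟨e, heb, he⟩ := mem_nhdsLE_iff_exists_Icc_subset.1 hev
  exact ⟨e, ⟨(he (left_mem_Icc.2 (le_of_lt heb))).1.1, heb⟩, fun t ht ↦ (he ht).2⟩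

/-- Every point near `γ a` precedes some point as near to `γ t` as desired, and points near `γ t`
precede `z`. -/
theorem IsSmoothCausalOn.eventually_inner {γ : ℝ → M} {a b : ℝ} (hab : a < b)
    (hγ : S.IsSmoothCausalOn γ a b) :
    ∀ᶠ t in 𝓝[>] a, ∀ z, S.Inner (γ t) z → S.Inner (γ a) z := by
  obtain ⟨e, he, hO⟩ := exists_Icc_right_subset hab hγ.1.continuousOn
    (S.isOpen_chartNhd (γ a)) (mem_chartNhd_self (γ a))
  have hc := (hγ.mono le_rfl he.2 he.1).causalOn (x₀ := γ a) he.1 (fun t ht ↦ (hO t ht).1)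
    fun t ht ↦ (hO t ht).2
  filter_upwards [hc.eventually_exists_link (S.lorentzPatch (γ a)) he.1, Ioc_mem_nhdsGT he.1]
    with t ht hte z hz
  have hts := hO t (Ioc_subset_Icc_self hte)
  have hB : {u | S.After ((extChartAt (𝓡 (n + 1)) (γ a)).symm u) z} ∈
      𝓝 (extChartAt (𝓡 (n + 1)) (γ a) (γ t)) := by
    have hcs := continuousAt_extChartAt_symm' (I := 𝓡 (n + 1)) (x := γ a) hts.1
    refine hcs.eventually (p := fun x ↦ S.After x z) ?_
    rw [(extChartAt (𝓡 (n + 1)) (γ a)).left_inv hts.1]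
    exact hz
  refine eventually_of_eventually_extChartAt (mem_extChartAt_source (γ a))
    ((ht _ hB).mono fun u hu ↦ ?_)
  obtain ⟨y, hy, hl⟩ := hu
  exact (after_of_piece (piece_of_link hl)).trans hy

/-- The parameters at which the property fails form a closed set. By `eventually_inner` failure at
one parameter before `b` implies failure at arbitrarily close later ones, so failure at `a` would
spread to `b`. -/
theorem IsSmoothCausalOn.inner {γ : ℝ → M} {a b : ℝ} (hab : a < b)
    (hγ : S.IsSmoothCausalOn γ a b) {z : M} (hz : S.Inner (γ b) z) : S.Inner (γ a) z := by
  by_contra hcon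
  have hcl : IsClosed ({t | ¬ S.Inner (γ t) z} ∩ Icc a b) := by
    rw [inter_comm]
    refine hγ.1.continuousOn.preimage_isClosed_of_isClosed (t := {x | ¬ S.Inner x z}) isClosed_Icc ?_
    exact isOpen_setOfPred_eventually_nhds.isClosed_compl
  refine hcl.Icc_subset_of_forall_exists_gt hcon (fun t ht y hy ↦ ?_) (right_mem_Icc.2 hab.le) hz
  have hev := (hγ.mono ht.2.1 le_rfl ht.2.2).eventually_inner ht.2.2
  obtain ⟨s, hs, hsy⟩ := (hev.and (Ioc_mem_nhdsGT hy)).exists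
  exact ⟨s, fun h ↦ ht.1 (hs z h), hsy⟩

theorem Inner.of_reflTransGen {x y z : M} (h : Relation.ReflTransGen S.Piece x y)
    (hz : S.Inner y z) : S.Inner x z := by
  induction h using Relation.ReflTransGen.head_induction_on with
  | refl => exact hz
  | head h _ ih =>
    obtain ⟨γ, a, b, hab, hγ, rfl, rfl⟩ := h
    exact hγ.inner hab ih

theorem sameRay_toCoord_iff {x₀ x y : M} (hxy : x = y)
    (hx : x ∈ (extChartAt (𝓡 (n + 1)) x₀).source) (v : TangentSpace (𝓡 (n + 1)) x)
    (w : TangentSpace (𝓡 (n + 1)) y) :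
    SameRay ℝ (toCoord x₀ x v) (toCoord x₀ y w) ↔
      SameRay ℝ (show EuclideanSpace ℝ (Fin (n + 1)) from v) w := by
  subst hxy
  exact (toCoord_injective hx).sameRay_map_iff

/-- Agreement of directions is independent of the chart and of the subintervals used for the
derivatives, so results in a patch transfer to the manifold. -/
theorem sameRay_derivWithin_iff {x₀ : M} {σ γ : ℝ → M} {a b a' b' c d c' d' s t : ℝ}
    (hσ : S.IsSmoothCausalOn σ a b) (hγ : S.IsSmoothCausalOn γ a' b') (hcd : c < d)
    (hcd' : c' < d') (hsub : Icc c d ⊆ Icc a b) (hsub' : Icc c' d' ⊆ Icc a' b')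
    (hs : s ∈ Icc c d) (ht : t ∈ Icc c' d') (hst : σ s = γ t)
    (hx : σ s ∈ (extChartAt (𝓡 (n + 1)) x₀).source) :
    SameRay ℝ (derivWithin (extChartAt (𝓡 (n + 1)) x₀ ∘ σ) (Icc c d) s)
      (derivWithin (extChartAt (𝓡 (n + 1)) x₀ ∘ γ) (Icc c' d') t) ↔
      SameRay ℝ (velocity (n := n) σ a b s) (velocity γ a' b' t) := by
  have h1 := hσ.1.mdifferentiableOn (by simp) s (hsub hs)
  have h2 := hγ.1.mdifferentiableOn (by simp) t (hsub' ht)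
  rw [derivWithin_extChartAt_comp hcd hs (h1.mono hsub) hx,
    derivWithin_extChartAt_comp hcd' ht (h2.mono hsub') (hst ▸ hx),
    ← velocity_mono hcd hsub hs h1, ← velocity_mono hcd' hsub' ht h2]
  exact sameRay_toCoord_iff hst hx _ _

theorem exists_inner_of_not_sameRay {σ γ : ℝ → M} {a b a' b' : ℝ} (hab : a < b) (hab' : a' < b')
    (hσ : S.IsSmoothCausalOn σ a b) (hγ : S.IsSmoothCausalOn γ a' b') (hσγ : σ b = γ a')
    (hray : ¬ SameRay ℝ (velocity (n := n) σ a b b) (velocity γ a' b' a')) :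
    ∃ t ∈ Ico a b, ∃ s ∈ Ioc a' b', S.Inner (σ t) (γ s) := by
  have hopen := S.isOpen_chartNhd (σ b)
  have hmem : σ b ∈ S.chartNhd (σ b) := mem_chartNhd_self (σ b)
  obtain ⟨e, he, hO⟩ := exists_Icc_left_subset hab hσ.1.continuousOn hopen hmem
  obtain ⟨e', he', hO'⟩ := exists_Icc_right_subset hab' hγ.1.continuousOn hopen (hσγ ▸ hmem)
  have hσ' := hσ.mono he.1 le_rfl he.2
  have hγ' := hγ.mono le_rfl he'.2 he'.1
  have hc := hσ'.causalOn (x₀ := σ b) he.2 (fun t ht ↦ (hO t ht).1) fun t ht ↦ (hO t ht).2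
  have hd := hγ'.causalOn (x₀ := σ b) he'.1 (fun t ht ↦ (hO' t ht).1) fun t ht ↦ (hO' t ht).2
  have hbI : b ∈ Icc e b := right_mem_Icc.2 he.2.le
  have haI : a' ∈ Icc a' e' := left_mem_Icc.2 he'.1.le
  have hray' : ¬ SameRay ℝ (derivWithin (extChartAt (𝓡 (n + 1)) (σ b) ∘ σ) (Icc e b) b)
      (derivWithin (extChartAt (𝓡 (n + 1)) (σ b) ∘ γ) (Icc a' e') a') := by
    rwa [sameRay_derivWithin_iff hσ hγ he.2 he'.1 (Icc_subset_Icc_left he.1)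
      (Icc_subset_Icc_right he'.2) hbI haI hσγ hmem.1]
  obtain ⟨t, ht, s, hs, hl⟩ := (S.lorentzPatch (σ b)).exists_eventually_link_of_not_sameRay
    he.2 he'.1 hc hd (by simp [hσγ]) hray'
  exact ⟨t, ⟨he.1.trans ht.1, ht.2⟩, s, ⟨hs.1, hs.2.trans he'.2⟩,
    inner_of_eventually_link (hO t (Ico_subset_Icc_self ht)).1 (hO' s (Ioc_subset_Icc_self hs)).1 hl⟩

end InnerPast

end Spacetime

namespace Spacetime

set_option linter.unusedSectionVars false

variable {n : ℕ} {M : Type*} [TopologicalSpace M]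
  [ChartedSpace (EuclideanSpace ℝ (Fin (n + 1))) M] [IsManifold (𝓡 (n + 1)) ∞ M]
  {S : Spacetime n M}

/-! ### Rigidity and continuation of tight curves -/

section Tight

variable (S) in
/-- No point of the curve lies in the interior of the causal past of a later one. -/
def Tight (γ : ℝ → M) (a b : ℝ) : Prop :=
  ∀ s ∈ Icc a b, ∀ t ∈ Icc a b, s < t → ¬ S.Inner (γ s) (γ t)

theorem Tight.mono {γ : ℝ → M} {a b a' b' : ℝ} (h : S.Tight γ a b) (hsub : Icc a' b' ⊆ Icc a b) :
    S.Tight γ a' b' :=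
  fun s hs t ht hst ↦ h s (hsub hs) t (hsub ht) hst

theorem IsSmoothCausalOn.velocity_ne_zero {γ : ℝ → M} {a b s : ℝ}
    (hγ : S.IsSmoothCausalOn γ a b) (hs : s ∈ Icc a b) : velocity (n := n) γ a b s ≠ 0 :=
  (hγ.2 s hs).1.1

/-- Tight curves that meet in the same direction agree for some time. -/
theorem Tight.exists_eq_and_sameRay {σ γ : ℝ → M} {a b a' b' s t : ℝ}
    (hσ : S.IsSmoothCausalOn σ a b) (hγ : S.IsSmoothCausalOn γ a' b')
    (hσt : S.Tight σ a b) (hγt : S.Tight γ a' b') (hs : s ∈ Ico a b) (ht : t ∈ Ico a' b')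
    (hst : σ s = γ t)
    (hray : SameRay ℝ (velocity (n := n) σ a b s) (velocity γ a' b' t)) :
    ∀ᶠ s' in 𝓝[>] s, ∃ t' ∈ Icc a' b', σ s' = γ t' ∧
      SameRay ℝ (velocity (n := n) σ a b s') (velocity γ a' b' t') := by
  have hopen := S.isOpen_chartNhd (σ s)
  have hmem : σ s ∈ S.chartNhd (σ s) := mem_chartNhd_self (σ s)
  have hσs := hσ.mono hs.1 le_rfl hs.2
  have hγs := hγ.mono ht.1 le_rfl ht.2
  obtain ⟨e, he, hO⟩ := exists_Icc_right_subset hs.2 hσs.1.continuousOn hopen hmem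
  obtain ⟨e', he', hO'⟩ := exists_Icc_right_subset ht.2 hγs.1.continuousOn hopen (hst ▸ hmem)
  have hsub : Icc s e ⊆ Icc a b := Icc_subset_Icc hs.1 he.2
  have hsub' : Icc t e' ⊆ Icc a' b' := Icc_subset_Icc ht.1 he'.2
  have hc := (hσs.mono le_rfl he.2 he.1).causalOn (x₀ := σ s) he.1 (fun t ht ↦ (hO t ht).1)
    fun t ht ↦ (hO t ht).2
  have hd := (hγs.mono le_rfl he'.2 he'.1).causalOn (x₀ := σ s) he'.1 (fun t ht ↦ (hO' t ht).1)
    fun t ht ↦ (hO' t ht).2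
  -- A link in the chart from all points near `σ t₁` to `σ t₂` would put `σ t₁` in the interior of
  -- the past of `σ t₂`, against tightness; likewise for `γ`.
  have key := (S.lorentzPatch (σ s)).exists_eq_and_sameRay he.1 he'.1 hc hd
    (fun t₁ h₁ t₂ h₂ hlt hl ↦ hσt t₁ (hsub h₁) t₂ (hsub h₂) hlt
      (inner_of_eventually_link (hO t₁ h₁).1 (hO t₂ h₂).1 hl))
    (fun t₁ h₁ t₂ h₂ hlt hl ↦ hγt t₁ (hsub' h₁) t₂ (hsub' h₂) hlt
      (inner_of_eventually_link (hO' t₁ h₁).1 (hO' t₂ h₂).1 hl))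
    (by simp [hst])
    ((sameRay_derivWithin_iff hσ hγ he.1 he'.1 hsub hsub' (left_mem_Icc.2 he.1.le)
      (left_mem_Icc.2 he'.1.le) hst hmem.1).2 hray)
  filter_upwards [key, Ioc_mem_nhdsGT he.1] with s' ⟨t', ht', heq, hr⟩ hs'
  have hs'I := Ioc_subset_Icc_self hs'
  have ht'I := Ioc_subset_Icc_self ht'
  have hpt : σ s' = γ t' := (extChartAt (𝓡 (n + 1)) (σ s)).injOn (hO s' hs'I).1 (hO' t' ht'I).1 heq
  exact ⟨t', hsub' ht'I, hpt, (sameRay_derivWithin_iff hσ hγ he.1 he'.1 hsub hsub' hs'I ht'I hpt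
    (hO s' hs'I).1).1 hr⟩

theorem continuousWithinAt_derivWithin_extChartAt {γ : ℝ → M} {a b s : ℝ} {x₀ : M} (hab : a < b)
    (hγ : S.IsSmoothCausalOn γ a b) (hs : s ∈ Icc a b)
    (hx : γ s ∈ (extChartAt (𝓡 (n + 1)) x₀).source) :
    ContinuousWithinAt (derivWithin (extChartAt (𝓡 (n + 1)) x₀ ∘ γ) (Icc a b)) (Icc a b) s := by
  have hx' : γ s ∈ (chartAt (EuclideanSpace ℝ (Fin (n + 1))) x₀).source := by
    rwa [← extChartAt_source (𝓡 (n + 1))]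
  have h1 : ContDiffWithinAt ℝ ∞ (extChartAt (𝓡 (n + 1)) x₀ ∘ γ) (Icc a b) s :=
    contMDiffWithinAt_iff_contDiffWithinAt.1
      ((contMDiffAt_extChartAt' hx').comp_contMDiffWithinAt s (hγ.1 s hs))
  have h2 := h1.fderivWithin_right (m := 0) (uniqueDiffOn_Icc hab) (by simp) hs
  exact h2.continuousWithinAt.clm_apply continuousWithinAt_const

/-- Coincidence of points is closed in a Hausdorff space. For directions, velocities near the limit
are read in one chart, where `SameRay` is the closed condition `‖v‖ • w = ‖w‖ • v`. -/
theorem isClosed_setOf_eq_and_sameRay [T2Space M] {σ γ : ℝ → M} {a b a' b' : ℝ} (hab : a < b)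
    (hab' : a' < b') (hσ : S.IsSmoothCausalOn σ a b) (hγ : S.IsSmoothCausalOn γ a' b') :
    IsClosed {p : ℝ × ℝ | p ∈ Icc a b ×ˢ Icc a' b' ∧ σ p.1 = γ p.2 ∧
      SameRay ℝ (velocity (n := n) σ a b p.1) (velocity γ a' b' p.2)} := by
  set K := {p : ℝ × ℝ | p ∈ Icc a b ×ˢ Icc a' b' ∧ σ p.1 = γ p.2 ∧
      SameRay ℝ (velocity (n := n) σ a b p.1) (velocity γ a' b' p.2)} with hK
  refine isClosed_of_closure_subset fun p hp ↦ ?_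
  have hpI : p ∈ Icc a b ×ˢ Icc a' b' :=
    closure_minimal (fun q hq ↦ hq.1) (isClosed_Icc.prod isClosed_Icc) hp
  have := mem_closure_iff_nhdsWithin_neBot.1 hp
  have hfst : Tendsto Prod.fst (𝓝[K] p) (𝓝[Icc a b] p.1) :=
    tendsto_nhdsWithin_iff.2 ⟨continuous_fst.continuousAt.mono_left nhdsWithin_le_nhds,
      by filter_upwards [self_mem_nhdsWithin] with q hq using hq.1.1⟩
  have hsnd : Tendsto Prod.snd (𝓝[K] p) (𝓝[Icc a' b'] p.2) :=
    tendsto_nhdsWithin_iff.2 ⟨continuous_snd.continuousAt.mono_left nhdsWithin_le_nhds,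
      by filter_upwards [self_mem_nhdsWithin] with q hq using hq.1.2⟩
  have h1 := (hσ.1.continuousOn p.1 hpI.1).tendsto.comp hfst
  have h2 := (hγ.1.continuousOn p.2 hpI.2).tendsto.comp hsnd
  have heq : σ p.1 = γ p.2 := tendsto_nhds_unique_of_eventuallyEq h1 h2 (by
    filter_upwards [self_mem_nhdsWithin] with q hq using hq.2.1)
  refine ⟨hpI, heq, ?_⟩
  set x₀ := σ p.1 with hx₀
  have hsrc : σ p.1 ∈ (extChartAt (𝓡 (n + 1)) x₀).source := mem_extChartAt_source x₀
  have hd1 := (continuousWithinAt_derivWithin_extChartAt hab hσ hpI.1 hsrc).tendsto.comp hfst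
  have hd2 := (continuousWithinAt_derivWithin_extChartAt (x₀ := x₀) hab' hγ hpI.2
    (heq ▸ hsrc)).tendsto.comp hsnd
  have hev : ∀ᶠ q in 𝓝[K] p, σ q.1 ∈ (extChartAt (𝓡 (n + 1)) x₀).source :=
    h1.eventually_mem ((isOpen_extChartAt_source x₀).mem_nhds hsrc)
  rw [← sameRay_derivWithin_iff (x₀ := x₀) hσ hγ hab hab' subset_rfl subset_rfl hpI.1 hpI.2 heq hsrc,
    sameRay_iff_norm_smul_eq]
  refine tendsto_nhds_unique_of_eventuallyEq (hd1.norm.smul hd2) (hd2.norm.smul hd1) ?_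
  filter_upwards [hev, self_mem_nhdsWithin] with q hq hqK
  exact sameRay_iff_norm_smul_eq.1 ((sameRay_derivWithin_iff (x₀ := x₀) hσ hγ hab hab' subset_rfl
    subset_rfl hqK.1.1 hqK.1.2 hqK.2.1 hq).2 hqK.2.2)

/-- Of two tight curves with the same start and the same initial direction, one runs along the
other up to its end. -/
theorem Tight.exists_end_eq [T2Space M] {σ γ : ℝ → M} {a b a' b' : ℝ} (hab : a < b)
    (hab' : a' < b') (hσ : S.IsSmoothCausalOn σ a b) (hγ : S.IsSmoothCausalOn γ a' b')
    (hσt : S.Tight σ a b) (hγt : S.Tight γ a' b') (h0 : σ a = γ a')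
    (hray : SameRay ℝ (velocity (n := n) σ a b a) (velocity γ a' b' a')) :
    (∃ t ∈ Icc a' b', σ b = γ t ∧
      SameRay ℝ (velocity (n := n) σ a b b) (velocity γ a' b' t)) ∨
    ∃ s ∈ Icc a b, σ s = γ b' ∧
      SameRay ℝ (velocity (n := n) σ a b s) (velocity γ a' b' b') := by
  by_cases hend : ∃ s ∈ Icc a b, σ s = γ b' ∧
      SameRay ℝ (velocity (n := n) σ a b s) (velocity γ a' b' b')
  · exact Or.inr hend
  refine Or.inl ?_
  set K := {p : ℝ × ℝ | p ∈ Icc a b ×ˢ Icc a' b' ∧ σ p.1 = γ p.2 ∧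
      SameRay ℝ (velocity (n := n) σ a b p.1) (velocity γ a' b' p.2)} with hK
  have hKc : IsCompact K := (isCompact_Icc.prod isCompact_Icc).of_isClosed_subset
    (isClosed_setOf_eq_and_sameRay hab hab' hσ hγ) fun p hp ↦ hp.1
  have hAcl : IsClosed (Prod.fst '' K) := (hKc.image continuous_fst).isClosed
  -- Continuation: the set of parameters of `σ` matched by `γ` is closed, contains `a`, and extends
  -- to the right as long as `γ` is not exhausted, which `hend` excludes.
  have hsub : Icc a b ⊆ Prod.fst '' K := by
    refine (hAcl.inter isClosed_Icc).Icc_subset_of_forall_exists_gt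
      ⟨(a, a'), ⟨⟨left_mem_Icc.2 hab.le, left_mem_Icc.2 hab'.le⟩, h0, hray⟩, rfl⟩ ?_
    rintro s ⟨⟨⟨s, t⟩, ⟨hst, heq, hr⟩, rfl⟩, hs⟩ y hy
    have htb : t < b' := hst.2.2.lt_of_ne fun h ↦ hend ⟨s, hst.1, h ▸ heq, h ▸ hr⟩
    obtain ⟨s', ⟨⟨t', ht', heq', hr'⟩, hs'b⟩, hs'y⟩ := (((Tight.exists_eq_and_sameRay hσ hγ hσt hγt
      hs ⟨hst.2.1, htb⟩ heq hr).and (Ioc_mem_nhdsGT hs.2)).and (Ioc_mem_nhdsGT hy)).exists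
    exact ⟨s', ⟨(s', t'), ⟨⟨⟨hs.1.trans hs'b.1.le, hs'b.2⟩, ht'⟩, heq', hr'⟩, rfl⟩, hs'y⟩
  obtain ⟨⟨s, t⟩, ⟨hst, heq, hr⟩, rfl⟩ := hsub (right_mem_Icc.2 hab.le)
  exact ⟨t, hst.2, heq, hr⟩

variable (S) in
/-- Chains of `k` tight curves from `x` to `y`, each starting in the direction in which the
preceding one ends, the first one in the direction `v`. -/
inductive TightChain : ℕ → M → EuclideanSpace ℝ (Fin (n + 1)) → M → Prop
  | nil (x : M) (v : EuclideanSpace ℝ (Fin (n + 1))) : TightChain 0 x v x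
  | cons {k : ℕ} {γ : ℝ → M} {a b : ℝ} {v : EuclideanSpace ℝ (Fin (n + 1))} {y : M} (hab : a < b)
      (hγ : S.IsSmoothCausalOn γ a b) (ht : S.Tight γ a b)
      (hv : SameRay ℝ v (velocity γ a b a)) (h : TightChain k (γ b) (velocity γ a b b) y) :
      TightChain (k + 1) (γ a) v y

theorem TightChain.reflTransGen {k : ℕ} {x y : M} {v : EuclideanSpace ℝ (Fin (n + 1))}
    (h : S.TightChain k x v y) : Relation.ReflTransGen S.Piece x y := by
  induction h with
  | nil => exact .refl
  | cons hab hγ _ _ _ ih => exact .head ⟨_, _, _, hab, hγ, rfl, rfl⟩ ih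

/-- The part of a tight chain after a point of its first curve. -/
theorem TightChain.drop {k : ℕ} {γ : ℝ → M} {a b t : ℝ} {v : EuclideanSpace ℝ (Fin (n + 1))} {y : M}
    (hγ : S.IsSmoothCausalOn γ a b) (ht : S.Tight γ a b)
    (h : S.TightChain k (γ b) (velocity γ a b b) y) (htI : t ∈ Icc a b)
    (hv : SameRay ℝ v (velocity (n := n) γ a b t)) (hv0 : v ≠ 0) :
    ∃ w ≠ 0, SameRay ℝ v w ∧ ∃ j ≤ k + 1, S.TightChain j (γ t) w y := by
  -- At `t = b` no part of the first curve is left and the chain loses one member; otherwise a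
  -- shortened first curve remains.
  rcases htI.2.eq_or_lt with rfl | htb
  · exact ⟨_, hγ.velocity_ne_zero htI, hv, k, by omega, h⟩
  · have hd : ∀ s ∈ Icc t b, velocity (n := n) γ t b s = velocity γ a b s := fun s hs ↦
      velocity_mono htb (Icc_subset_Icc_left htI.1) hs
        (hγ.1.mdifferentiableOn (by simp) s ⟨htI.1.trans hs.1, hs.2⟩)
    refine ⟨v, hv0, SameRay.rfl, k + 1, le_rfl, ?_⟩
    refine .cons htb (hγ.mono htI.1 le_rfl htb) (ht.mono (Icc_subset_Icc_left htI.1)) ?_ ?_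
    · rwa [hd t (left_mem_Icc.2 htb.le)]
    · rwa [hd b (right_mem_Icc.2 htb.le)]

/-- The end points of two tight chains with the same start and the same direction are
comparable. -/
theorem TightChain.comparable [T2Space M] : ∀ (N : ℕ) {k l : ℕ} {x y z : M}
    {v w : EuclideanSpace ℝ (Fin (n + 1))}, k + l ≤ N → S.TightChain k x v y →
    S.TightChain l x w z → v ≠ 0 → w ≠ 0 → SameRay ℝ v w →
    Relation.ReflTransGen S.Piece y z ∨ Relation.ReflTransGen S.Piece z y := by
  intro N
  -- Induction on the total number of curves: one of the two first curves is used up entirely, while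
  -- the other chain does not get longer.
  induction N with
  | zero =>
    intro k l x y z v w hN h h' _ _ _
    obtain ⟨rfl, rfl⟩ : k = 0 ∧ l = 0 := by omega
    cases h
    cases h'
    exact Or.inl .refl
  | succ N ih =>
    intro k l x y z v w hN h h' hv hw hvw
    cases h with
    | nil => exact Or.inl h'.reflTransGen
    | @cons k σ a b _ _ hab hσ hσt hσv hσc =>
      generalize hx : σ a = x at h'
      cases h' with
      | nil =>
        subst hx
        exact Or.inr (TightChain.cons hab hσ hσt hσv hσc).reflTransGen
      | @cons l γ a' b' _ _ hab' hγ hγt hγw hγc =>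
        have hσ0 := hσ.velocity_ne_zero (left_mem_Icc.2 hab.le)
        have hray : SameRay ℝ (velocity (n := n) σ a b a) (velocity γ a' b' a') :=
          (hσv.symm.trans hvw fun h ↦ absurd h hv).trans hγw fun h ↦ absurd h hw
        rcases Tight.exists_end_eq hab hab' hσ hγ hσt hγt hx hray with
          ⟨t, ht, heq, hr⟩ | ⟨s, hs, heq, hr⟩
        · have h0 := hσ.velocity_ne_zero (right_mem_Icc.2 hab.le)
          obtain ⟨w', hw', hvw', j, hj, hch⟩ := TightChain.drop hγ hγt hγc ht hr h0
          rw [← heq] at hch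
          exact ih (by omega) hσc hch h0 hw' hvw'
        · have h0 := hγ.velocity_ne_zero (right_mem_Icc.2 hab'.le)
          obtain ⟨w', hw', hvw', j, hj, hch⟩ := TightChain.drop hσ hσt hσc hs hr.symm h0
          rw [heq] at hch
          exact ih (by omega) hch hγc hw' h0 hvw'.symm

/-- A causal curve that does not start in the interior of the causal past of its end continues
as a chain of tight curves. -/
theorem exists_tightChain {z y : M} (h : Relation.ReflTransGen S.Piece z y) :
    ∀ {σ : ℝ → M} {a b : ℝ}, a < b → S.IsSmoothCausalOn σ a b → σ b = z →
      ¬ S.Inner (σ a) y → ∃ k, S.TightChain k z (velocity σ a b b) y := by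
  induction h using Relation.ReflTransGen.head_induction_on with
  | refl => exact fun _ _ _ _ ↦ ⟨0, .nil _ _⟩
  | head hp hrest ih =>
    obtain ⟨γ, a', b', hab', hγ, rfl, rfl⟩ := hp
    intro σ a b hab hσ hσb hno
    have hstart : ∀ {t}, t ∈ Icc a' b' → Relation.ReflTransGen S.Piece (σ a) (γ t) := fun ht ↦
      (hσb ▸ hσ.reflTransGen le_rfl hab.le le_rfl).trans (hγ.reflTransGen le_rfl ht.1 ht.2)
    have hfinish : ∀ {t}, t ∈ Icc a' b' → Relation.ReflTransGen S.Piece (γ t) _ := fun ht ↦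
      (hγ.reflTransGen ht.1 ht.2 le_rfl).trans hrest
    -- A corner here could be cut, and the resulting interior relation would propagate back to `σ a`
    -- and on to `y`.
    have hray : SameRay ℝ (velocity (n := n) σ a b b) (velocity γ a' b' a') := by
      by_contra hcon
      obtain ⟨t, ht, s, hs, hin⟩ := exists_inner_of_not_sameRay hab hab' hσ hγ hσb hcon
      exact hno (Inner.of_reflTransGen (hσ.reflTransGen le_rfl ht.1 ht.2.le)
        (hin.trans_reflTransGen (hfinish (Ioc_subset_Icc_self hs))))
    have htight : S.Tight γ a' b' := fun s hs t ht _ hin ↦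
      hno (Inner.of_reflTransGen (hstart hs) (hin.trans_reflTransGen (hfinish ht)))
    obtain ⟨k, hk⟩ := ih hab' hγ rfl fun hin ↦
      hno (Inner.of_reflTransGen (hstart (left_mem_Icc.2 hab'.le)) hin)
    exact ⟨k + 1, .cons hab' hγ htight hray hk⟩

end Tight

/-! ### Incomparable points and the interior of causal pasts -/

/-- If two points after a point after `x` are not comparable, then `x` lies in the interior of the
causal past of one of them. -/
theorem inner_or_inner [T2Space M] {x z y₁ y₂ : M} (hxz : S.After x z) (h₁ : S.After z y₁)
    (h₂ : S.After z y₂) (hne : y₁ ≠ y₂) (h₁₂ : ¬ S.After y₁ y₂) (h₂₁ : ¬ S.After y₂ y₁) :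
    S.Inner x y₁ ∨ S.Inner x y₂ := by
  by_contra! hno
  rw [after_iff_transGen] at hxz h₁ h₂ h₁₂ h₂₁
  -- The last piece `σ` before `z` is shared by both curves; its final velocity is the common
  -- initial direction of the two chains.
  obtain ⟨x', hxx', σ, a, b, hab, hσ, rfl, hσz⟩ := Relation.TransGen.tail'_iff.1 hxz
  obtain ⟨k, hk⟩ := exists_tightChain h₁.to_reflTransGen hab hσ hσz fun h ↦
    hno.1 (Inner.of_reflTransGen hxx' h)
  obtain ⟨l, hl⟩ := exists_tightChain h₂.to_reflTransGen hab hσ hσz fun h ↦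
    hno.2 (Inner.of_reflTransGen hxx' h)
  have h0 := hσ.velocity_ne_zero (right_mem_Icc.2 hab.le)
  rcases TightChain.comparable (k + l) le_rfl hk hl h0 h0 SameRay.rfl with h | h
  · rcases Relation.reflTransGen_iff_eq_or_transGen.1 h with h | h
    · exact hne h.symm
    · exact h₁₂ h
  · rcases Relation.reflTransGen_iff_eq_or_transGen.1 h with h | h
    · exact hne h
    · exact h₂₁ h

/-- A causal curve that starts in the interior of a causal past stays there for some time. -/
theorem Inner.exists_after {x y w : M} (h : S.Inner x y) (hw : S.After x w) :
    ∃ u, S.After x u ∧ S.After u y ∧ S.After u w := by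
  rw [after_iff_transGen] at hw
  obtain ⟨x', ⟨γ, a, b, hab, hγ, rfl, rfl⟩, hrest⟩ := Relation.TransGen.head'_iff.1 hw
  have hlim : Tendsto γ (𝓝[>] a) (𝓝 (γ a)) := by
    rw [← nhdsWithin_Ioo_eq_nhdsGT hab]
    exact (hγ.1.continuousOn a (left_mem_Icc.2 hab.le)).mono Ioo_subset_Icc_self
  obtain ⟨t, ht, htab⟩ := ((hlim.eventually h).and (Ioo_mem_nhdsGT hab)).exists
  exact ⟨γ t, after_of_piece (hγ.piece le_rfl htab.1 htab.2.le), ht,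
    (after_of_piece (hγ.piece htab.1.le htab.2 le_rfl)).trans_reflTransGen hrest⟩

end Spacetime

/-! ### Kripke semantics and validity of the after formula -/

namespace ModalFormula

variable {AP W : Type*} {R : W → W → Prop} {V : AP → Set W} {x : W} {φ ψ : ModalFormula AP}

theorem sat_and : Sat R V x (and φ ψ) ↔ Sat R V x φ ∧ Sat R V x ψ := by
  simp [and, Sat]

theorem sat_imp : Sat R V x (imp φ ψ) ↔ (Sat R V x φ → Sat R V x ψ) := by
  simp [imp, Sat, imp_iff_not_or]

theorem sat_dia : Sat R V x (dia φ) ↔ ∃ y, R x y ∧ Sat R V y φ := by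
  simp [dia, Sat]

end ModalFormula

theorem mainTheorem1 {n : ℕ} {M : Type*} [TopologicalSpace M] [T2Space M]
    [ChartedSpace (EuclideanSpace ℝ (Fin (n + 1))) M] [IsManifold (𝓡 (n + 1)) ∞ M]
    (S : Spacetime n M) {AP : Type*} (p₁ p₂ q : AP) :
    ModalFormula.ValidOn S.After (ModalFormula.afterFormula p₁ p₂ q) := by
  intro V x
  simp only [ModalFormula.afterFormula, ModalFormula.sat_imp, ModalFormula.sat_and,
    ModalFormula.sat_dia, ModalFormula.Sat]
  rintro ⟨⟨z, hxz, ⟨y₁, hy₁, hp₁, hn₂, ha₂⟩, y₂, hy₂, hp₂, hn₁, ha₁⟩, w, hxw, hq⟩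
  -- The points differ because `p₁` holds at `y₁` only; each boxed negation excludes one of the two
  -- orders.
  rcases Spacetime.inner_or_inner hxz hy₁ hy₂ (fun h ↦ hn₁ (h ▸ hp₁)) (fun h ↦ ha₂ y₂ h hp₂)
    (fun h ↦ ha₁ y₁ h hp₁) with h | h
  · obtain ⟨u, hxu, huy, huw⟩ := h.exists_after hxw
    exact Or.inl ⟨u, hxu, ⟨y₁, huy, hp₁⟩, w, huw, hq⟩
  · obtain ⟨u, hxu, huy, huw⟩ := h.exists_after hxw
    exact Or.inr ⟨u, hxu, ⟨y₂, huy, hp₂⟩, w, huw, hq⟩
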